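/- Let $\mathbb{T}^2=(\mathbb{R}/\mathbb{Z})\times(\mathbb{R}/\mathbb{Z})$ be the torus. Let $M$ be a connected sum $\mathbb{T}^2\#\mathbb{T}^2$ (the two-holed torus), that is, a topological space homeomorphic to one obtained as follows: choose open embeddings $e_1,e_2:\mathbb{R}^2\to\mathbb{T}^2$ and a homeomorphism $\varphi:S^1\to S^1$ of the unit circle, remove from the $i$-th copy of $\mathbb{T}^2$ the open disc $e_i(\{|z|<1\})$ $(i=1,2)$, and glue the two remaining spaces along their boundary circles by identifying $e_1(z)$ with $e_2(\varphi(z))$ for every $z\in S^1$. Then for every base point $x_0\in M$, $$\pi_1(M,x_0)\;\cong\;\big\langle \alpha_1,\beta_1,\alpha_2,\beta_2 \;\big|\; [\alpha_1,\beta_1][\alpha_2,\beta_2]\big\rangle,\qquad\text{where } [\alpha_i,\beta_i]=\beta_i\alpha_i\beta_i^{-1}\alpha_i^{-1}.$$ -/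

import Mathlib

open Topology

/-- A regular coordinate ball in an `n`-dimensional space `X`: an open coordinate patch
`ℝⁿ → X`. The open ball it singles out is the image of the open unit ball of `ℝⁿ`; since the
coordinates extend beyond the closed unit ball, the boundary of that ball is the image of the unit
sphere. -/
structure RegularBall (n : ℕ) (X : Type*) [TopologicalSpace X] where
  /-- The coordinate patch. -/
  toFun : EuclideanSpace ℝ (Fin n) → X
  isOpenEmbedding : IsOpenEmbedding toFun

namespace RegularBall

variable {n : ℕ} {X : Type*} [TopologicalSpace X]

/-- What is left of `X` when the open ball is removed, as a subset of `X`. -/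
def complement (e : RegularBall n X) : Set X :=
  (e.toFun '' Metric.ball 0 1)ᶜ

theorem apply_mem_complement (e : RegularBall n X)
    (z : Metric.sphere (0 : EuclideanSpace ℝ (Fin n)) 1) : e.toFun z ∈ e.complement := by
  rintro ⟨w, hw, h⟩
  have hwz : w = z := e.isOpenEmbedding.injective h
  have hz := z.2
  rw [hwz, Metric.mem_ball] at hw
  rw [Metric.mem_sphere] at hz
  exact absurd hz hw.ne

/-- The parametrized boundary sphere of the removed ball. -/
def boundary (e : RegularBall n X) (z : Metric.sphere (0 : EuclideanSpace ℝ (Fin n)) 1) :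
    e.complement :=
  ⟨e.toFun z, e.apply_mem_complement z⟩

end RegularBall

section ConnectedSum

variable {n : ℕ} {X Y : Type*} [TopologicalSpace X] [TopologicalSpace Y]

/-- The identification of the two boundary spheres along a homeomorphism `φ` of the sphere. -/
inductive GlueRel (e : RegularBall n X) (f : RegularBall n Y)
    (φ : Metric.sphere (0 : EuclideanSpace ℝ (Fin n)) 1 ≃ₜ
      Metric.sphere (0 : EuclideanSpace ℝ (Fin n)) 1) :
    e.complement ⊕ f.complement → e.complement ⊕ f.complement → Prop
  | glue (z : Metric.sphere (0 : EuclideanSpace ℝ (Fin n)) 1) :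
      GlueRel e f φ (Sum.inl (e.boundary z)) (Sum.inr (f.boundary (φ z)))

/-- The space obtained by removing an open ball from each of `X` and `Y` and gluing the boundary
spheres along `φ`, with the quotient topology. (`Quot` divides by the equivalence relation
generated by `GlueRel`.) -/
abbrev GluedSum (e : RegularBall n X) (f : RegularBall n Y)
    (φ : Metric.sphere (0 : EuclideanSpace ℝ (Fin n)) 1 ≃ₜ
      Metric.sphere (0 : EuclideanSpace ℝ (Fin n)) 1) : Type _ :=
  Quot (GlueRel e f φ)

end ConnectedSum

/-- `M` is (homeomorphic to) a connected sum of the `n`-dimensional spaces `X` and `Y`, for some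
choice of the removed balls and of the gluing homeomorphism. -/
def IsConnectedSum (n : ℕ) (M X Y : Type*) [TopologicalSpace M] [TopologicalSpace X]
    [TopologicalSpace Y] : Prop :=
  ∃ (e : RegularBall n X) (f : RegularBall n Y)
    (φ : Metric.sphere (0 : EuclideanSpace ℝ (Fin n)) 1 ≃ₜ
      Metric.sphere (0 : EuclideanSpace ℝ (Fin n)) 1),
    Nonempty (M ≃ₜ GluedSum e f φ)

/-- The torus `(ℝ/ℤ) × (ℝ/ℤ)`. -/
abbrev Torus : Type := UnitAddCircle × UnitAddCircle

/-- The four generators. -/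
inductive TwoHoledGen : Type
  | α₁ | β₁ | α₂ | β₂

/-- The relator `[α₁, β₁][α₂, β₂]`, where `[α, β] = β α β⁻¹ α⁻¹`. -/
def twoHoledRelator : FreeGroup TwoHoledGen :=
  let α₁ := FreeGroup.of TwoHoledGen.α₁
  let β₁ := FreeGroup.of TwoHoledGen.β₁
  let α₂ := FreeGroup.of TwoHoledGen.α₂
  let β₂ := FreeGroup.of TwoHoledGen.β₂
  (β₁ * α₁ * β₁⁻¹ * α₁⁻¹) * (β₂ * α₂ * β₂⁻¹ * α₂⁻¹)

/-! Filling each removed disc with an inverted collar of the other torus turns the glued space `Q`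
into a union of two open sets, each homeomorphic to a torus without a point, whose overlap is a
punctured plane. The gluing map `φ` extends radially to `z ↦ ‖z‖⁻¹ φ(z/‖z‖)`, which matches the two
coordinate patches off their centers. The group of a punctured torus is free of rank two, the group
of the overlap is generated by one loop, and on either side this loop becomes the commutator of a
free basis. Van Kampen's theorem then amalgamates two free groups along a commutator.

Fundamental groups are handled through path cocycles: group-valued functions of paths that are
multiplicative and homotopy invariant. Compatible cocycles on an open cover glue uniquely
(`exists_glue`, `PathCocycle.eval_eq_of_local`). With paths chosen from a base point, homomorphisms
on the group are cocycles, so gluing gives van Kampen's theorem as a universal property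
(`vanKampen_exists`, `vanKampen_unique`).

On the torus without `(1/2, 1/2)`, a path is read as a word: a letter `a` for each crossing of `x =
1/2` and `b` for each crossing of `y = 1/2`. Since the point where the two circles meet is missing,
the letters need not commute. The two coordinate loops read `a` and `b`, so they are free, and they
generate by van Kampen for two cylinders. A loop around the puncture reads a commutator.

The patches and `φ` are arbitrary, so orientations and wild charts must be absorbed. Small loops in
two charts at the same center generate conjugate subgroups (`exists_range_hom_eq_conj`). In a free
group this determines the loop up to conjugation and inversion, and an automorphism corrects both
(`exists_freeGroup_mulEquiv`). -/

open unitInterval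

/-! ### Cocycles on paths -/

/-- A group-valued function on the paths of a space that is multiplicative under concatenation and
invariant under homotopy relative to the endpoints. The order of the factors is the one of the
composition in `FundamentalGroup`. -/
structure PathCocycle (X G : Type*) [TopologicalSpace X] [Group G] where
  /-- The value on a path. -/
  val : ∀ {x y : X}, Path x y → G
  val_trans : ∀ {x y z : X} (p : Path x y) (q : Path y z), val (p.trans q) = val q * val p
  val_homotopic : ∀ {x y : X} {p q : Path x y}, p.Homotopic q → val p = val q

/-- A continuous map on the unit interval as a path between its end points. -/
def ContinuousMap.asPath {X : Type*} [TopologicalSpace X] (r : C(I, X)) : Path (r 0) (r 1) :=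
  ⟨r, rfl, rfl⟩

namespace PathCocycle

variable {X Y G : Type*} [TopologicalSpace X] [TopologicalSpace Y] [Group G]

/-- The value of a cocycle on an unbundled path. -/
def eval (F : PathCocycle X G) (r : C(I, X)) : G := F.val r.asPath

theorem eval_coe (F : PathCocycle X G) {x y : X} (p : Path x y) :
    F.eval p.toContinuousMap = F.val p := by
  obtain ⟨r, rfl, rfl⟩ := p
  rfl

theorem val_eq_eval (F : PathCocycle X G) {x y : X} (p : Path x y) (r : C(I, X))
    (h : ∀ t, p t = r t) : F.val p = F.eval r := by
  rw [← eval_coe]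
  congr 1
  ext t
  exact h t

theorem val_congr (F : PathCocycle X G) {x y x' y' : X} (p : Path x y) (q : Path x' y')
    (h : ∀ t, p t = q t) : F.val p = F.val q := by
  rw [← F.eval_coe q]
  exact F.val_eq_eval p _ h

theorem val_refl (F : PathCocycle X G) (x : X) : F.val (Path.refl x) = 1 := by
  have h := F.val_trans (Path.refl x) (Path.refl x)
  rw [F.val_homotopic (Path.Homotopic.refl_trans (Path.refl x))] at h
  exact left_eq_mul.mp h

theorem val_symm (F : PathCocycle X G) {x y : X} (p : Path x y) :
    F.val p.symm = (F.val p)⁻¹ := by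
  rw [eq_inv_iff_mul_eq_one, ← F.val_trans, F.val_homotopic (Path.Homotopic.trans_symm p),
    F.val_refl]

/-- The pullback of a cocycle along a continuous map. -/
def comap (F : PathCocycle X G) (f : C(Y, X)) : PathCocycle Y G where
  val p := F.val (p.map f.continuous)
  val_trans p q := by rw [Path.map_trans, F.val_trans]
  val_homotopic h := F.val_homotopic (h.map f)

theorem eval_comap (F : PathCocycle X G) (f : C(Y, X)) (r : C(I, Y)) :
    (F.comap f).eval r = F.eval (f.comp r) := by
  exact F.val_eq_eval _ _ fun t => rfl

/-- A function on the points defines a cocycle. -/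
def ofGauge (g : X → G) : PathCocycle X G where
  val {x y} _ := g y * (g x)⁻¹
  val_trans p q := by group
  val_homotopic _ := rfl

/-- The homomorphism on the fundamental group defined by a cocycle. -/
def hom (F : PathCocycle X G) (x : X) : FundamentalGroup X x →* G where
  toFun := Quotient.lift (fun p : Path x x => F.val p) fun _ _ h => F.val_homotopic h
  map_one' := F.val_refl x
  map_mul' := by
    rintro ⟨p⟩ ⟨q⟩
    exact F.val_trans q p

/-- With all paths between two points homotopic, the value along any path from a fixed base point
serves as a primitive. -/
theorem exists_gauge [SimplyConnectedSpace X] (F : PathCocycle X G) :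
    ∃ g : X → G, ∀ {x y : X} (p : Path x y), F.val p * g x = g y := by
  obtain ⟨x₀⟩ : Nonempty X := inferInstance
  refine ⟨fun x => F.val (PathConnectedSpace.somePath x₀ x), fun {x y} p => ?_⟩
  rw [← F.val_trans]
  exact F.val_homotopic (SimplyConnectedSpace.paths_homotopic _ _)

end PathCocycle

/-! ### Primitives and the gluing of cocycles over an open cover -/

section Primitive

variable {X G ι K L : Type*} [TopologicalSpace X] [TopologicalSpace K] [TopologicalSpace L]
  [Group G] {U : ι → Set X}

/-- The function `g` integrates over `N` the pullback along `H` of the cocycles `F i`, which are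
defined over the sets `U i`. -/
def IsPrimitiveOn (F : ∀ i, PathCocycle (U i) G) (H : C(K, X)) (N : Set K) (g : K → G) : Prop :=
  ∀ i (q : C(I, K)) (r : C(I, U i)), (∀ t, q t ∈ N) → (∀ t, (r t : X) = H (q t)) →
    (F i).eval r * g (q 0) = g (q 1)

/-- The function `g` integrates the pullback along `H` of the cocycles `F i` near each point. -/
def IsLocalPrimitive (F : ∀ i, PathCocycle (U i) G) (H : C(K, X)) (g : K → G) : Prop :=
  ∀ x, ∃ N ∈ 𝓝 x, IsPrimitiveOn F H N g

variable {F : ∀ i, PathCocycle (U i) G}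

theorem IsPrimitiveOn.mono {H : C(K, X)} {N N' : Set K} {g : K → G} (h : IsPrimitiveOn F H N g)
    (hN : N' ⊆ N) : IsPrimitiveOn F H N' g :=
  fun i q r hq => h i q r fun t => hN (hq t)

theorem IsPrimitiveOn.isLocalPrimitive {H : C(K, X)} {g : K → G}
    (h : IsPrimitiveOn F H Set.univ g) : IsLocalPrimitive F H g :=
  fun _ => ⟨Set.univ, Filter.univ_mem, h⟩

theorem IsPrimitiveOn.comp {H : C(K, X)} {N : Set K} {g : K → G} (h : IsPrimitiveOn F H N g)
    (f : C(L, K)) : IsPrimitiveOn F (H.comp f) (f ⁻¹' N) (g ∘ f) :=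
  fun i q r hq hr => h i (f.comp q) r hq hr

theorem IsLocalPrimitive.comp {H : C(K, X)} {g : K → G} (h : IsLocalPrimitive F H g)
    (f : C(L, K)) : IsLocalPrimitive F (H.comp f) (g ∘ f) := fun x => by
  obtain ⟨N, hN, h⟩ := h (f x)
  exact ⟨f ⁻¹' N, f.continuous.continuousAt hN, h.comp f⟩

/-- The cocycle acts on primitives from the left, so along a path it cancels in the quotient `g'⁻¹ *
g`. -/
theorem IsPrimitiveOn.ratio_eq {H : C(K, X)} {N : Set K} {g g' : K → G}
    (h : IsPrimitiveOn F H N g) (h' : IsPrimitiveOn F H N g') {i : ι} (hi : ∀ x ∈ N, H x ∈ U i)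
    {a b : K} (hab : JoinedIn N a b) : (g' b)⁻¹ * g b = (g' a)⁻¹ * g a := by
  obtain ⟨p, hp⟩ := hab
  let r : C(I, U i) := ⟨fun t => ⟨H (p t), hi _ (hp t)⟩, by fun_prop⟩
  have e := h i p.toContinuousMap r hp fun t => rfl
  have e' := h' i p.toContinuousMap r hp fun t => rfl
  simp only [Path.coe_toContinuousMap, p.source, p.target] at e e'
  rw [← e, ← e']
  group

theorem IsLocalPrimitive.ratio_eq [PreconnectedSpace K] [LocallyPathConnectedSpace K]
    (hU : ∀ i, IsOpen (U i)) (hcov : ∀ x, ∃ i, x ∈ U i)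
    {H : C(K, X)} {g g' : K → G} (h : IsLocalPrimitive F H g) (h' : IsLocalPrimitive F H g')
    (a b : K) : (g' b)⁻¹ * g b = (g' a)⁻¹ * g a := by
  have : IsLocallyConstant fun x => (g' x)⁻¹ * g x := by
    rw [IsLocallyConstant.iff_eventually_eq]
    intro x
    obtain ⟨i, hi⟩ := hcov (H x)
    obtain ⟨N, hN, h⟩ := h x
    obtain ⟨N', hN', h'⟩ := h' x
    have hV : N ∩ N' ∩ H ⁻¹' U i ∈ 𝓝 x :=
      Filter.inter_mem (Filter.inter_mem hN hN') (H.continuous.continuousAt ((hU i).mem_nhds hi))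
    obtain ⟨W, ⟨hWx, hWp⟩, hWN⟩ := (path_connected_basis x).mem_iff.mp hV
    filter_upwards [hWx] with y hy
    exact (h.mono fun z hz => (hWN hz).1.1).ratio_eq (h'.mono fun z hz => (hWN hz).1.2)
      (i := i) (fun z hz => (hWN hz).2) (hWp.joinedIn _ (mem_of_mem_nhds hWx) _ hy)
  exact this.apply_eq_of_preconnectedSpace b a

theorem IsLocalPrimitive.quotient_eq [PreconnectedSpace K] [LocallyPathConnectedSpace K]
    (hU : ∀ i, IsOpen (U i)) (hcov : ∀ x, ∃ i, x ∈ U i)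
    {H : C(K, X)} {g g' : K → G} (h : IsLocalPrimitive F H g) (h' : IsLocalPrimitive F H g')
    (a b : K) : g b * (g a)⁻¹ = g' b * (g' a)⁻¹ := by
  have e := h.ratio_eq hU hcov h' a b
  rw [inv_mul_eq_iff_eq_mul] at e
  rw [e]
  group

/-- Cocycles that agree on the paths lying in two of the sets `U i`. -/
def Compatible (F : ∀ i, PathCocycle (U i) G) : Prop :=
  ∀ i j (r : C(I, U i)) (r' : C(I, U j)), (∀ t, (r t : X) = r' t) → (F i).eval r = (F j).eval r'

/-- A gauge of the one cocycle `F i` suffices: compatibility replaces every other `F j` by it along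
paths in `N`. -/
theorem exists_isPrimitiveOn_of_simplyConnected (hF : Compatible F) (H : C(K, X)) {N : Set K}
    (hN : SimplyConnectedSpace N) {i : ι} (hi : ∀ x ∈ N, H x ∈ U i) :
    ∃ g : K → G, IsPrimitiveOn F H N g := by
  classical
  let f : C(N, U i) := ⟨fun x => ⟨H x, hi _ x.2⟩, by fun_prop⟩
  obtain ⟨g, hg⟩ := ((F i).comap f).exists_gauge
  refine ⟨fun x => if hx : x ∈ N then g ⟨x, hx⟩ else 1, fun j q r hq hr => ?_⟩
  let q' : C(I, N) := ⟨fun t => ⟨q t, hq t⟩, by fun_prop⟩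
  simp only [hq, dif_pos]
  rw [hF j i r (f.comp q') fun t => hr t, ← PathCocycle.eval_comap]
  exact hg q'.asPath

section Star

variable {E : Type*} [NormedAddCommGroup E] [NormedSpace ℝ E]

/-- The product of the `k` first steps, out of `n`, on the way from the origin to `x`. -/
noncomputable def stepProd (f : E → E → G) (n : ℕ) (x : E) : ℕ → G
  | 0 => 1
  | k + 1 => f (((k : ℝ) / n) • x) (((k + 1 : ℕ) / n : ℝ) • x) * stepProd f n x k

/-- Two nearby rays from the origin are compared rung by rung. Each small quadrilateral between them
commutes because its diagonal is still shorter than `δ`, so the discrepancy after `k` steps is the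
single increment across the `k`-th rung. -/
theorem stepProd_eq {f : E → E → G} {δ R : ℝ} {n : ℕ} (hn : R / n < δ / 2)
    (hf : ∀ s t u, dist s t < δ → dist s u < δ → dist t u < δ → f t u * f s t = f s u)
    {x y : E} (hx : ‖x‖ < R) (hy : ‖y‖ < R) (hxy : dist x y < δ / 2) (k : ℕ) (hk : k ≤ n) :
    stepProd f n y k = f (((k : ℝ) / n) • x) (((k : ℝ) / n) • y) * stepProd f n x k := by
  have hδ : 0 < δ := pos_of_mul_pos_left (dist_nonneg.trans_lt hxy) (by norm_num)
  induction k with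
  | zero =>
    have := hf (0 : E) 0 0 (by simpa) (by simpa) (by simpa)
    simp [stepProd, mul_eq_left.mp this]
  | succ k ih =>
    have hn0 : (0 : ℝ) < n := by
      have : 0 < n := by lia
      exact_mod_cast this
    have hd : ∀ c : ℝ, 0 ≤ c → c ≤ 1 → dist (c • x) (c • y) < δ / 2 := fun c h0 h1 => by
      rw [dist_smul₀, Real.norm_of_nonneg h0]
      exact (mul_le_of_le_one_left dist_nonneg h1).trans_lt hxy
    have hs : ∀ z : E, ‖z‖ < R →
        dist (((k : ℝ) / n) • z) ((((k + 1 : ℕ) : ℝ) / n) • z) < δ / 2 := fun z hz => by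
      rw [dist_eq_norm, ← sub_smul, norm_smul]
      have : (k : ℝ) / n - ((k + 1 : ℕ) : ℝ) / n = -(1 / n) := by push_cast; ring
      rw [this, norm_neg, Real.norm_of_nonneg (by positivity), one_div_mul_eq_div]
      exact (div_le_div_of_nonneg_right hz.le hn0.le).trans_lt hn
    have hk0 : (0 : ℝ) ≤ (k : ℝ) / n := by positivity
    have hk1 : (k : ℝ) / n ≤ 1 := by
      rw [div_le_one hn0]
      exact_mod_cast (by lia : k ≤ n)
    have hk2 : (0 : ℝ) ≤ ((k + 1 : ℕ) : ℝ) / n := by positivity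
    have hk3 : ((k + 1 : ℕ) : ℝ) / n ≤ 1 := by
      rw [div_le_one hn0]
      exact_mod_cast hk
    have h1 := hd _ hk0 hk1
    have h2 := hd _ hk2 hk3
    have h3 := hs x hx
    have h4 := hs y hy
    have h5 : dist (((k : ℝ) / n) • x) ((((k + 1 : ℕ) : ℝ) / n) • y) < δ :=
      (dist_triangle _ _ _).trans_lt ((add_lt_add h1 h4).trans_eq (add_halves δ))
    have h6 : δ / 2 < δ := half_lt_self hδ
    rw [stepProd, stepProd, ih (by lia), ← mul_assoc, ← mul_assoc,
      hf _ _ _ (h1.trans h6) h5 (h4.trans h6), hf _ _ _ (h3.trans h6) h5 (h2.trans h6)]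

/-- On each ball of radius `δ` a primitive exists since the ball is contractible. Its increments `f
s t` satisfy the cocycle rule for triples of mutual distance below `δ`, because two primitives
differ by a constant on a convex overlap. Multiplying increments along rays from the origin develops
them into one function. -/
theorem exists_primitive_near (hF : Compatible F) (H : C(E, X)) {δ : ℝ} (hδ : 0 < δ)
    (h : ∀ x, ∃ i, ∀ y ∈ Metric.ball x δ, H y ∈ U i) (R : ℝ) :
    ∃ g : E → G, ∀ x ∈ Metric.ball (0 : E) R, ∃ N ∈ 𝓝 x, IsPrimitiveOn F H N g := by
  choose i hi using h
  have hc : ∀ x : E, ∃ g : E → G, IsPrimitiveOn F H (Metric.ball x δ) g := fun x => by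
    have : ContractibleSpace (Metric.ball x δ) :=
      (convex_ball x δ).contractibleSpace ⟨x, Metric.mem_ball_self hδ⟩
    exact exists_isPrimitiveOn_of_simplyConnected hF H inferInstance (hi x)
  choose g hg using hc
  let f : E → E → G := fun s t => g s t * (g s s)⁻¹
  have hf : ∀ s t u, dist s t < δ → dist s u < δ → dist t u < δ → f t u * f s t = f s u := by
    intro s t u hst hsu htu
    have hconv : Convex ℝ (Metric.ball s δ ∩ Metric.ball t δ) :=
      (convex_ball s δ).inter (convex_ball t δ)
    have ht : t ∈ Metric.ball s δ ∩ Metric.ball t δ :=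
      ⟨by rwa [Metric.mem_ball'], Metric.mem_ball_self hδ⟩
    have hu : u ∈ Metric.ball s δ ∩ Metric.ball t δ :=
      ⟨by rwa [Metric.mem_ball'], by rwa [Metric.mem_ball']⟩
    have e := ((hg s).mono Set.inter_subset_left).ratio_eq ((hg t).mono Set.inter_subset_right)
      (i := i s) (fun x hx => hi s x hx.1) ((hconv.isPathConnected ⟨t, ht⟩).joinedIn t ht u hu)
    rw [inv_mul_eq_iff_eq_mul] at e
    simp only [f, e]
    group
  obtain ⟨n, hn⟩ := exists_nat_gt (R / (δ / 2))
  have hn' : ∀ x ∈ Metric.ball (0 : E) R, R / n < δ / 2 ∧ (n : ℝ) ≠ 0 := fun x hx => by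
    have hR : 0 < R := Metric.pos_of_mem_ball hx
    have h0 : (0 : ℝ) < n := lt_trans (by positivity) hn
    refine ⟨?_, h0.ne'⟩
    rw [div_lt_iff₀ (by positivity)] at hn
    rwa [div_lt_iff₀ h0, mul_comm]
  -- Radius `δ / 4` keeps any two points of the neighborhood less than `δ / 2` apart, as the
  -- comparison of rays requires.
  refine ⟨fun x => stepProd f n x n, fun x hx => ⟨Metric.ball x (δ / 4) ∩ Metric.ball 0 R,
    Filter.inter_mem (Metric.ball_mem_nhds x (by positivity)) (Metric.isOpen_ball.mem_nhds hx),
    fun j q r hq hr => ?_⟩⟩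
  have hqq : ∀ t, dist (q 0) (q t) < δ / 2 := fun t => by
    have h0 := (hq 0).1
    have h1 := (hq t).1
    rw [Metric.mem_ball] at h0 h1
    have := dist_triangle_right (q 0) (q t) x
    linarith
  obtain ⟨hn1, hn2⟩ := hn' x hx
  have key := stepProd_eq hn1 hf (mem_ball_zero_iff.mp (hq 0).2) (mem_ball_zero_iff.mp (hq 1).2)
    (hqq 1) n le_rfl
  rw [div_self hn2, one_smul, one_smul] at key
  have e := hg (q 0) j q r (fun t => by rw [Metric.mem_ball']; linarith [hqq t]) hr
  beta_reduce
  rw [key]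
  simp only [f, ← e]
  group

end Star

/-- Compactness supplies a Lebesgue number `δ`. The retraction extends `H` to the whole normed
space, and being 1-Lipschitz it preserves `δ`; the primitive found there is restricted to `K`. -/
theorem exists_isLocalPrimitive {E K : Type*} [NormedAddCommGroup E] [NormedSpace ℝ E]
    [PseudoMetricSpace K] [CompactSpace K] (emb : C(K, E)) {ret : E → K}
    (hret : LipschitzWith 1 ret) (hre : ∀ x, ret (emb x) = x)
    (hU : ∀ i, IsOpen (U i)) (hcov : ∀ x, ∃ i, x ∈ U i)
    (hF : Compatible F) (H : C(K, X)) : ∃ g : K → G, IsLocalPrimitive F H g := by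
  obtain ⟨δ, hδ, h⟩ := lebesgue_number_lemma_of_metric (c := fun i => H ⁻¹' U i)
    (isCompact_univ (X := K)) (fun i => (hU i).preimage H.continuous)
    fun x _ => Set.mem_iUnion.mpr (hcov (H x))
  obtain ⟨R, hR⟩ := (isCompact_range emb.continuous).isBounded.subset_ball (0 : E)
  obtain ⟨g, hg⟩ := exists_primitive_near hF (H.comp ⟨ret, hret.continuous⟩) hδ
    (fun x => (h (ret x) trivial).imp fun i hi y hy => hi <| by
      rw [Metric.mem_ball] at hy ⊢
      exact (hret.dist_le_mul y x).trans_lt (by simpa using hy)) R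
  refine ⟨g ∘ emb, fun x => ?_⟩
  obtain ⟨N, hN, hp⟩ := hg (emb x) (hR ⟨x, rfl⟩)
  refine ⟨emb ⁻¹' N, emb.continuous.continuousAt hN, ?_⟩
  have := hp.comp emb
  have e : (H.comp ⟨ret, hret.continuous⟩).comp emb = H := by
    ext y
    exact congrArg H (hre y)
  rwa [e] at this

instance unitInterval.locallyPathConnectedSpace : LocallyPathConnectedSpace I :=
  (isQuotientMap_projIcc (h := zero_le_one' ℝ)).locallyPathConnectedSpace

instance unitInterval.contractibleSpace : ContractibleSpace I :=
  (convex_Icc (0 : ℝ) 1).contractibleSpace ⟨0, by simp⟩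

section Glue

theorem exists_isLocalPrimitive_path (hU : ∀ i, IsOpen (U i)) (hcov : ∀ x, ∃ i, x ∈ U i)
    (hF : Compatible F) (H : C(I, X)) :
    ∃ g : I → G, IsLocalPrimitive F H g :=
  exists_isLocalPrimitive (E := ℝ) ⟨Subtype.val, continuous_subtype_val⟩
    (LipschitzWith.projIcc (zero_le_one' ℝ)) (Set.projIcc_val _) hU hcov hF H

theorem exists_isLocalPrimitive_square (hU : ∀ i, IsOpen (U i)) (hcov : ∀ x, ∃ i, x ∈ U i)
    (hF : Compatible F) (H : C(I × I, X)) :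
    ∃ g : I × I → G, IsLocalPrimitive F H g := by
  have hp := LipschitzWith.projIcc (zero_le_one' ℝ)
  refine exists_isLocalPrimitive (E := ℝ × ℝ) ⟨fun x => (x.1, x.2), by fun_prop⟩
    (ret := fun x => (Set.projIcc 0 1 zero_le_one x.1, Set.projIcc 0 1 zero_le_one x.2))
    ?_ (fun x => ?_) hU hcov hF H
  · have := (hp.comp LipschitzWith.prod_fst).prodMk (hp.comp LipschitzWith.prod_snd)
    simpa using this
  · exact Prod.ext (Set.projIcc_val zero_le_one _) (Set.projIcc_val zero_le_one _)

theorem IsLocalPrimitive.eq_of_const (hU : ∀ i, IsOpen (U i)) (hcov : ∀ x, ∃ i, x ∈ U i)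
    {H : C(I, X)} {x : X} (hH : ∀ t, H t = x) {g : I → G}
    (h : IsLocalPrimitive F H g) (a b : I) : g a = g b := by
  have h1 : IsPrimitiveOn F H Set.univ fun _ => 1 := by
    intro i q r _ hr
    have : (F i).eval r = 1 := by
      rw [← (F i).val_refl (r 0)]
      refine ((F i).val_eq_eval _ _ fun t => Subtype.ext ?_).symm
      rw [Path.refl_apply, hr, hr, hH, hH]
    rw [this, one_mul]
  simpa using h.ratio_eq hU hcov h1.isLocalPrimitive b a

/-- A path is assigned `k 1 * (k 0)⁻¹` for any local primitive `k` along it; connectedness of the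
interval makes this independent of `k`. Multiplicativity comes from restricting a primitive to the
two halves of a concatenation, homotopy invariance from a primitive on the square. -/
theorem exists_glue (hU : ∀ i, IsOpen (U i)) (hcov : ∀ x, ∃ i, x ∈ U i)
    (hF : Compatible F) :
    ∃ Φ : PathCocycle X G, ∀ i (r : C(I, U i)),
      Φ.eval (ContinuousMap.comp ⟨Subtype.val, continuous_subtype_val⟩ r) = (F i).eval r := by
  choose g hg using exists_isLocalPrimitive_path hU hcov hF
  have huniq : ∀ (γ : C(I, X)) (k : I → G), IsLocalPrimitive F γ k →
      g γ 1 * (g γ 0)⁻¹ = k 1 * (k 0)⁻¹ := fun γ k hk =>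
    (hg γ).quotient_eq hU hcov hk 0 1
  refine ⟨⟨fun p => g p.toContinuousMap 1 * (g p.toContinuousMap 0)⁻¹, ?_, ?_⟩, ?_⟩
  · intro x y z p q
    have hpq := hg (p.trans q).toContinuousMap
    set k := g (p.trans q).toContinuousMap
    let f₀ : C(I, I) := ⟨fun t => ⟨t / 2, by constructor <;> linarith [t.2.1, t.2.2]⟩, by fun_prop⟩
    let f₁ : C(I, I) := ⟨fun t => ⟨(1 + t) / 2, by constructor <;> linarith [t.2.1, t.2.2]⟩,
      by fun_prop⟩
    have e₀ : (p.trans q).toContinuousMap.comp f₀ = p.toContinuousMap := by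
      ext t
      have ht : (t : ℝ) / 2 ≤ 1 / 2 := by linarith [t.2.2]
      simp only [ContinuousMap.comp_apply, Path.coe_toContinuousMap, Path.trans_apply, f₀,
        ContinuousMap.coe_mk, dif_pos ht]
      congr 1
      ext
      exact mul_div_cancel₀ _ two_ne_zero
    have e₁ : (p.trans q).toContinuousMap.comp f₁ = q.toContinuousMap := by
      ext t
      have h := Path.extend_trans_of_half_le p q (t := (1 + t) / 2) (by linarith [t.2.1])
      have e : 2 * ((1 + (t : ℝ)) / 2) - 1 = t := by ring
      rw [e, Path.extend_extends'] at h
      exact (Path.extend_extends' (p.trans q) (f₁ t)).symm.trans h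
    have h₀ := huniq _ _ (e₀ ▸ hpq.comp f₀)
    have h₁ := huniq _ _ (e₁ ▸ hpq.comp f₁)
    have i₀ : f₀ 0 = 0 := by ext; simp [f₀]
    have i₁ : f₁ 1 = 1 := by ext; norm_num [f₁]
    have i₂ : f₁ 0 = f₀ 1 := by ext; simp [f₀, f₁]
    simp only [Function.comp_apply, i₀, i₁, i₂] at h₀ h₁
    rw [h₀, h₁]
    group
  · rintro x y p q ⟨h⟩
    obtain ⟨k, hk⟩ := exists_isLocalPrimitive_square hU hcov hF h.toContinuousMap
    have hrow : ∀ s : I, Continuous fun t : I => (s, t) := fun s => by fun_prop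
    have hcol : ∀ s : I, Continuous fun t : I => (t, s) := fun s => by fun_prop
    have e₀ : h.toContinuousMap.comp ⟨_, hrow 0⟩ = p.toContinuousMap := by
      ext t; exact h.apply_zero t
    have e₁ : h.toContinuousMap.comp ⟨_, hrow 1⟩ = q.toContinuousMap := by
      ext t; exact h.apply_one t
    -- One primitive on the square computes both values through its two rows; the homotopy is
    -- constant on the two sides, so the corner values agree.
    rw [huniq _ _ (e₀ ▸ hk.comp ⟨_, hrow 0⟩), huniq _ _ (e₁ ▸ hk.comp ⟨_, hrow 1⟩)]
    have c₀ := (hk.comp ⟨_, hcol 0⟩).eq_of_const hU hcov (x := x) (fun t => h.source t) 0 1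
    have c₁ := (hk.comp ⟨_, hcol 1⟩).eq_of_const hU hcov (x := y) (fun t => h.target t) 0 1
    simp only [Function.comp_apply, ContinuousMap.coe_mk] at c₀ c₁ ⊢
    rw [c₀, c₁]
  · intro i r
    obtain ⟨k, hk⟩ := ((F i).comap r).exists_gauge
    have hprim : IsPrimitiveOn F
        (ContinuousMap.comp ⟨Subtype.val, continuous_subtype_val⟩ r) Set.univ k := by
      intro j q r' _ hr'
      rw [hF j i r' (r.comp q) hr', ← PathCocycle.eval_comap]
      exact hk q.asPath
    have e := hk (ContinuousMap.id I).asPath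
    have e' : ((F i).comap r).val (ContinuousMap.id I).asPath = (F i).eval r :=
      (F i).val_eq_eval _ _ fun t => rfl
    rw [e'] at e
    refine (huniq _ _ hprim.isLocalPrimitive).trans ?_
    exact mul_inv_eq_of_eq_mul e.symm

/-- Global gauges of both cocycles along the path are local primitives of the same local data, and
such primitives have equal end quotients. -/
theorem PathCocycle.eval_eq_of_local (hU : ∀ i, IsOpen (U i)) (hcov : ∀ x, ∃ i, x ∈ U i)
    (Φ Ψ : PathCocycle X G)
    (h : ∀ i (r : C(I, X)), (∀ t, r t ∈ U i) → Φ.eval r = Ψ.eval r) (r : C(I, X)) :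
    Φ.eval r = Ψ.eval r := by
  let F : ∀ i, PathCocycle (U i) G := fun i => Φ.comap ⟨Subtype.val, continuous_subtype_val⟩
  have key : ∀ Θ : PathCocycle X G,
      (∀ i (r : C(I, X)), (∀ t, r t ∈ U i) → Φ.eval r = Θ.eval r) →
      ∃ k : I → G, IsLocalPrimitive F r k ∧ Θ.eval r = k 1 * (k 0)⁻¹ := by
    intro Θ hΘ
    obtain ⟨k, hk⟩ := (Θ.comap r).exists_gauge
    refine ⟨k, IsPrimitiveOn.isLocalPrimitive fun i q r' _ hr' => ?_, ?_⟩
    · have e : (F i).eval r' = (Θ.comap r).eval q := by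
        simp only [F, PathCocycle.eval_comap]
        rw [hΘ i _ fun t => (r' t).2]
        congr 1
        ext t
        exact hr' t
      rw [e]
      exact hk q.asPath
    · have e := hk (ContinuousMap.id I).asPath
      have e' : (Θ.comap r).val (ContinuousMap.id I).asPath = Θ.eval r :=
        Θ.val_eq_eval _ _ fun t => rfl
      rw [e'] at e
      exact eq_mul_inv_of_mul_eq e
  obtain ⟨k, hk, e⟩ := key Φ fun _ _ _ => rfl
  obtain ⟨k', hk', e'⟩ := key Ψ h
  rw [e, e', hk.quotient_eq hU hcov hk']

end Glue

end Primitive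

/-! ### Homomorphisms as cocycles and van Kampen's theorem -/

namespace PathCocycle

variable {X Y G : Type*} [TopologicalSpace X] [TopologicalSpace Y] [Group G]

/-- The cocycle that closes up each path along chosen paths from the base point. -/
noncomputable def ofHom {x₀ : X} (h : FundamentalGroup X x₀ →* G) (c : ∀ x, Path x₀ x) :
    PathCocycle X G where
  val {x y} p := h (FundamentalGroup.fromPath
    (((Path.Homotopic.Quotient.mk (c x)).trans (Path.Homotopic.Quotient.mk p)).trans
      (Path.Homotopic.Quotient.mk (c y)).symm))
  val_trans {x y z} p q := by
    rw [← map_mul, FundamentalGroup.mul_def, Path.Homotopic.Quotient.mk_trans]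
    simp only [Path.Homotopic.Quotient.trans_assoc]
    congr 3
    rw [← Path.Homotopic.Quotient.trans_assoc _ (Path.Homotopic.Quotient.mk (c y)),
      Path.Homotopic.Quotient.symm_trans, Path.Homotopic.Quotient.refl_trans]
  val_homotopic hpq := by rw [Path.Homotopic.Quotient.eq.mpr hpq]

theorem ofHom_val_of_refl {x₀ : X} (h : FundamentalGroup X x₀ →* G) {c : ∀ x, Path x₀ x}
    (hc : c x₀ = Path.refl x₀) (p : Path x₀ x₀) :
    (ofHom h c).val p = h (FundamentalGroup.fromPath (Path.Homotopic.Quotient.mk p)) := by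
  simp only [ofHom, hc, Path.Homotopic.Quotient.mk_refl, Path.Homotopic.Quotient.refl_trans]
  congr 2
  rw [← Path.Homotopic.Quotient.mk_refl, ← Path.Homotopic.Quotient.mk_symm, Path.refl_symm,
    Path.Homotopic.Quotient.mk_refl, Path.Homotopic.Quotient.trans_refl]

theorem ofHom_val_map (f : C(Y, X)) {y₀ : Y} (h : FundamentalGroup X (f y₀) →* G)
    {c : ∀ x, Path (f y₀) x} {c' : ∀ y, Path y₀ y} (hc : ∀ y, c (f y) = (c' y).map f.continuous)
    {y z : Y} (p : Path y z) :
    (ofHom h c).val (p.map f.continuous) =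
      (ofHom (h.comp (FundamentalGroup.map f y₀)) c').val p := by
  simp only [ofHom, MonoidHom.comp_apply, hc]
  rw [← Path.Homotopic.Quotient.mk_symm, ← Path.Homotopic.Quotient.mk_trans,
    ← Path.Homotopic.Quotient.mk_trans, ← Path.map_trans, Path.map_symm, ← Path.map_trans,
    ← Path.Homotopic.Quotient.mk_symm, ← Path.Homotopic.Quotient.mk_trans,
    ← Path.Homotopic.Quotient.mk_trans]
  rfl

end PathCocycle

section VanKampen

variable {X : Type*} [TopologicalSpace X]

/-- The inclusion of a subset, as a continuous map. -/
def Set.valMap (U : Set X) : C(U, X) := ⟨Subtype.val, continuous_subtype_val⟩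

/-- The inclusion of a subset into a larger one, as a continuous map. -/
def Set.inclMap {U V : Set X} (h : U ⊆ V) : C(U, V) := ⟨Set.inclusion h, continuous_inclusion h⟩

/-- A path in a space all of whose points lie in a subset, as a path in the subset. -/
def Path.codRestrict {x y : X} (p : Path x y) {U : Set X} (h : ∀ t, p t ∈ U) :
    Path (⟨x, p.source ▸ h 0⟩ : U) ⟨y, p.target ▸ h 1⟩ where
  toFun t := ⟨p t, h t⟩
  continuous_toFun := by fun_prop
  source' := Subtype.ext p.source
  target' := Subtype.ext p.target

/-- Three connectedness hypotheses serve the three possible positions of `x`. Paths that stay in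
each set containing their end point make the associated cocycles restrict well to `U`, `V` and `U ∩
V`; the constant path at `x₀` avoids a conjugation on loops. -/
theorem exists_path_system {U V : Set X} (hUV : U ∪ V = Set.univ) (pU : IsPathConnected U)
    (pV : IsPathConnected V) (pW : IsPathConnected (U ∩ V)) {x₀ : X} (h₀ : x₀ ∈ U ∩ V) :
    ∃ c : ∀ x, Path x₀ x, c x₀ = Path.refl x₀ ∧ (∀ x ∈ U, ∀ t, c x t ∈ U) ∧
      ∀ x ∈ V, ∀ t, c x t ∈ V := by
  have : ∀ x, ∃ p : Path x₀ x, (x = x₀ → ∀ t, p t = x₀) ∧ (x ∈ U → ∀ t, p t ∈ U) ∧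
      (x ∈ V → ∀ t, p t ∈ V) := fun x => by
    by_cases hx : x = x₀
    · subst hx
      exact ⟨Path.refl x, fun _ _ => rfl, fun h _ => h, fun h _ => h⟩
    by_cases hU : x ∈ U <;> by_cases hV : x ∈ V
    · obtain ⟨p, hp⟩ := pW.joinedIn x₀ h₀ x ⟨hU, hV⟩
      exact ⟨p, fun h => absurd h hx, fun _ t => (hp t).1, fun _ t => (hp t).2⟩
    · obtain ⟨p, hp⟩ := pU.joinedIn x₀ h₀.1 x hU
      exact ⟨p, fun h => absurd h hx, fun _ t => hp t, fun h => absurd h hV⟩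
    · obtain ⟨p, hp⟩ := pV.joinedIn x₀ h₀.2 x hV
      exact ⟨p, fun h => absurd h hx, fun h => absurd h hU, fun _ t => hp t⟩
    · have : x ∈ U ∪ V := hUV ▸ trivial
      exact (this.elim hU hV).elim
  choose c h₁ h₂ h₃ using this
  exact ⟨c, Path.ext (funext fun t => h₁ x₀ rfl t), h₂, h₃⟩

/-- The homomorphisms become cocycles on `U` and `V`. On the overlap both come from one homomorphism
on its group with the same path system, hence agree, and the glued cocycle restricts to loops at
`x₀`. -/
theorem vanKampen_exists {G : Type*} [Group G] {U V : Set X} (oU : IsOpen U) (oV : IsOpen V)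
    (hUV : U ∪ V = Set.univ) (pU : IsPathConnected U)
    (pV : IsPathConnected V) (pW : IsPathConnected (U ∩ V)) {x₀ : X} (h₀ : x₀ ∈ U ∩ V)
    (hU : FundamentalGroup U ⟨x₀, h₀.1⟩ →* G) (hV : FundamentalGroup V ⟨x₀, h₀.2⟩ →* G)
    (hW : ∀ γ : FundamentalGroup ↥(U ∩ V) ⟨x₀, h₀⟩,
      hU (FundamentalGroup.map (Set.inclMap Set.inter_subset_left) _ γ) =
      hV (FundamentalGroup.map (Set.inclMap Set.inter_subset_right) _ γ)) :
    ∃ h : FundamentalGroup X x₀ →* G,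
      (∀ γ, h (FundamentalGroup.map U.valMap (⟨x₀, h₀.1⟩ : U) γ) = hU γ) ∧
      ∀ γ, h (FundamentalGroup.map V.valMap (⟨x₀, h₀.2⟩ : V) γ) = hV γ := by
  obtain ⟨c, hc, cU, cV⟩ := exists_path_system hUV pU pV pW h₀
  let c₁ : ∀ u : U, Path ⟨x₀, h₀.1⟩ u := fun u => (c u).codRestrict (cU u u.2)
  let c₂ : ∀ u : V, Path ⟨x₀, h₀.2⟩ u := fun u => (c u).codRestrict (cV u u.2)
  let c₃ : ∀ u : ↥(U ∩ V), Path ⟨x₀, h₀⟩ u := fun u =>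
    (c u).codRestrict (U := U ∩ V) fun t => ⟨cU u u.2.1 t, cV u u.2.2 t⟩
  have hc₁ : c₁ ⟨x₀, h₀.1⟩ = Path.refl (⟨x₀, h₀.1⟩ : U) := Path.ext (funext fun t => Subtype.ext (by
    change c x₀ t = x₀
    rw [hc, Path.refl_apply]))
  have hc₂ : c₂ ⟨x₀, h₀.2⟩ = Path.refl (⟨x₀, h₀.2⟩ : V) := Path.ext (funext fun t => Subtype.ext (by
    change c x₀ t = x₀
    rw [hc, Path.refl_apply]))
  let S : Bool → Set X := fun b => cond b U V
  let F : ∀ b, PathCocycle (S b) G := fun b =>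
    match b with
    | true => PathCocycle.ofHom hU c₁
    | false => PathCocycle.ofHom hV c₂
  have oS : ∀ b, IsOpen (S b) := fun b => by cases b <;> assumption
  have hS : ∀ x, ∃ b, x ∈ S b := fun x => by
    have : x ∈ U ∪ V := hUV ▸ trivial
    exact this.elim (fun h => ⟨true, h⟩) fun h => ⟨false, h⟩
  have key : ∀ (r : C(I, U)) (r' : C(I, V)), (∀ t, (r t : X) = r' t) →
      (PathCocycle.ofHom hU c₁).eval r = (PathCocycle.ofHom hV c₂).eval r' := by
    intro r r' hr
    let s : C(I, ↥(U ∩ V)) := ⟨fun t => ⟨r t, (r t).2, hr t ▸ (r' t).2⟩, by fun_prop⟩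
    have e₁ := PathCocycle.ofHom_val_map (Set.inclMap Set.inter_subset_left) hU
      (c := c₁) (c' := c₃) (fun y => rfl) s.asPath
    have e₂ := PathCocycle.ofHom_val_map (Set.inclMap Set.inter_subset_right) hV
      (c := c₂) (c' := c₃) (fun y => rfl) s.asPath
    have e₃ := congrArg (fun h => (PathCocycle.ofHom h c₃).val s.asPath)
      (MonoidHom.ext hW : hU.comp (FundamentalGroup.map (Set.inclMap Set.inter_subset_left) _) =
        hV.comp (FundamentalGroup.map (Set.inclMap Set.inter_subset_right) _))
    have e₄ := e₁.trans (e₃.trans e₂.symm)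
    rwa [PathCocycle.val_eq_eval _ _ r fun t => rfl,
      PathCocycle.val_eq_eval _ _ r' fun t => Subtype.ext (hr t)] at e₄
  have hF : Compatible F := by
    intro i j r r' hr
    cases i <;> cases j
    · rw [ContinuousMap.ext fun t => Subtype.ext (hr t)]
    · exact (key r' r fun t => (hr t).symm).symm
    · exact key r r' hr
    · rw [ContinuousMap.ext fun t => Subtype.ext (hr t)]
  obtain ⟨Φ, hΦ⟩ := exists_glue oS hS hF
  refine ⟨Φ.hom x₀, ?_, ?_⟩
  · rintro ⟨p⟩
    refine (Φ.val_eq_eval _ _ fun t => rfl).trans ((hΦ true p.toContinuousMap).trans ?_)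
    exact (PathCocycle.eval_coe _ p).trans (PathCocycle.ofHom_val_of_refl hU hc₁ p)
  · rintro ⟨p⟩
    refine (Φ.val_eq_eval _ _ fun t => rfl).trans ((hΦ false p.toContinuousMap).trans ?_)
    exact (PathCocycle.eval_coe _ p).trans (PathCocycle.ofHom_val_of_refl hV hc₂ p)

/-- The cocycles of `h` and `h'` agree on paths inside either open set, hence on all paths. -/
theorem vanKampen_unique {G : Type*} [Group G] {U V : Set X} (oU : IsOpen U) (oV : IsOpen V)
    (hUV : U ∪ V = Set.univ) (pU : IsPathConnected U)
    (pV : IsPathConnected V) (pW : IsPathConnected (U ∩ V)) {x₀ : X} (h₀ : x₀ ∈ U ∩ V)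
    {h h' : FundamentalGroup X x₀ →* G}
    (hU : ∀ γ, h (FundamentalGroup.map U.valMap (⟨x₀, h₀.1⟩ : U) γ) =
      h' (FundamentalGroup.map U.valMap (⟨x₀, h₀.1⟩ : U) γ))
    (hV : ∀ γ, h (FundamentalGroup.map V.valMap (⟨x₀, h₀.2⟩ : V) γ) =
      h' (FundamentalGroup.map V.valMap (⟨x₀, h₀.2⟩ : V) γ)) : h = h' := by
  obtain ⟨c, hc, cU, cV⟩ := exists_path_system hUV pU pV pW h₀
  let S : Bool → Set X := fun b => cond b U V
  have oS : ∀ b, IsOpen (S b) := fun b => by cases b <;> assumption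
  have hS : ∀ x, ∃ b, x ∈ S b := fun x => by
    have : x ∈ U ∪ V := hUV ▸ trivial
    exact this.elim (fun h => ⟨true, h⟩) fun h => ⟨false, h⟩
  have key : ∀ (A : Set X) (hA : ∀ x ∈ A, ∀ t, c x t ∈ A) (hx : x₀ ∈ A),
      (∀ γ, h (FundamentalGroup.map A.valMap (⟨x₀, hx⟩ : A) γ) =
        h' (FundamentalGroup.map A.valMap (⟨x₀, hx⟩ : A) γ)) →
      ∀ r : C(I, X), (∀ t, r t ∈ A) →
        (PathCocycle.ofHom h c).eval r = (PathCocycle.ofHom h' c).eval r := by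
    intro A hA hx hh r hr
    let c' : ∀ u : A, Path ⟨x₀, hx⟩ u := fun u => (c u).codRestrict (hA u u.2)
    let s : C(I, A) := ⟨fun t => ⟨r t, hr t⟩, by fun_prop⟩
    have e := PathCocycle.ofHom_val_map A.valMap (y₀ := ⟨x₀, hx⟩) h
      (c := c) (c' := c') (fun y => rfl) s.asPath
    have e' := PathCocycle.ofHom_val_map A.valMap (y₀ := ⟨x₀, hx⟩) h'
      (c := c) (c' := c') (fun y => rfl) s.asPath
    have e₃ := congrArg (fun h => (PathCocycle.ofHom h c').val s.asPath)
      (MonoidHom.ext hh : h.comp (FundamentalGroup.map A.valMap (⟨x₀, hx⟩ : A)) =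
        h'.comp (FundamentalGroup.map A.valMap (⟨x₀, hx⟩ : A)))
    exact e.trans (e₃.trans e'.symm)
  ext ⟨p⟩
  have := PathCocycle.eval_eq_of_local oS hS (PathCocycle.ofHom h c) (PathCocycle.ofHom h' c)
    (fun b => by
      cases b
      · exact key V cV h₀.2 hV
      · exact key U cU h₀.1 hU) p.toContinuousMap
  rw [PathCocycle.eval_coe, PathCocycle.eval_coe, PathCocycle.ofHom_val_of_refl _ hc,
    PathCocycle.ofHom_val_of_refl _ hc] at this
  exact this

end VanKampen

/-! ### Cyclic generation by path lifting; the punctured plane -/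

section Cyclic

variable {E B : Type*} [TopologicalSpace E] [TopologicalSpace B]

theorem exists_path_system_refl [PathConnectedSpace B] (b : B) :
    ∃ c : ∀ x, Path b x, c b = Path.refl b := by
  classical
  refine ⟨fun x => if h : x = b then (Path.refl b).cast rfl h else PathConnectedSpace.somePath b x,
    ?_⟩
  exact dif_pos rfl

/-- The tautological cocycle with values in the group of `B` acquires a gauge `k` on the simply
connected `E`. Each lift of `r` multiplies it by `[r]`, so `k (T n) = [r]ⁿ * k (T 0)`; a loop whose
lift ends at `T n` is therefore `[r]ⁿ`. Only existence of lifts is used, not uniqueness. -/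
theorem zpowers_eq_top_of_lifts [SimplyConnectedSpace E] [PathConnectedSpace B] (p : C(E, B))
    {b : B} (r : Path b b) (T : ℤ → E)
    (lift : ∀ γ : Path b b, ∃ Γ : C(I, E), Γ 0 = T 0 ∧ ∀ t, p (Γ t) = γ t)
    (fib : ∀ x, p x = b → ∃ n, T n = x) (q : ∀ n, Path (T n) (T (n + 1)))
    (hq : ∀ n t, p (q n t) = r t) :
    Subgroup.zpowers (FundamentalGroup.fromPath (Path.Homotopic.Quotient.mk r)) = ⊤ := by
  obtain ⟨c, hc⟩ := exists_path_system_refl b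
  let F := PathCocycle.ofHom (MonoidHom.id (FundamentalGroup B b)) c
  have hF : ∀ γ : Path b b, F.val γ = FundamentalGroup.fromPath (Path.Homotopic.Quotient.mk γ) :=
    PathCocycle.ofHom_val_of_refl _ hc
  obtain ⟨k, hk⟩ := (F.comap p).exists_gauge
  have hstep : ∀ n, F.val r * k (T n) = k (T (n + 1)) := fun n => by
    rw [← hk (q n)]
    congr 1
    exact F.val_congr _ _ fun t => (hq n t).symm
  have hpow : ∀ n : ℤ, k (T n) = F.val r ^ n * k (T 0) := fun n => by
    induction n using Int.induction_on with
    | zero => simp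
    | succ n ih => rw [← hstep, ih, ← mul_assoc, ← zpow_one_add, add_comm]
    | pred n ih =>
      have := hstep (-n - 1)
      rw [sub_add_cancel, ih, ← eq_inv_mul_iff_mul_eq] at this
      rw [this, ← mul_assoc, ← zpow_neg_one, ← zpow_add]
      congr 2
      ring
  rw [eq_top_iff]
  rintro ⟨γ⟩ -
  obtain ⟨Γ, h0, h⟩ := lift γ
  obtain ⟨n, hn⟩ := fib (Γ 1) (by rw [h, γ.target])
  refine ⟨n, ?_⟩
  have e := hk Γ.asPath
  have e' : (F.comap p).val Γ.asPath = F.val γ := F.val_congr _ _ h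
  rw [e', h0, ← hn, hpow n, mul_left_inj] at e
  have e₂ := hF γ
  rw [e, hF] at e₂
  exact e₂

end Cyclic

section PuncturedPlane

/-- The Euclidean plane. -/
abbrev Plane : Type := EuclideanSpace ℝ (Fin 2)

/-- The plane without the origin. -/
abbrev PuncturedPlane : Type := ({0}ᶜ : Set Plane)

/-- The complex plane as the Euclidean plane. -/
noncomputable def complexPlane : ℂ ≃ₗᵢ[ℝ] Plane := Complex.orthonormalBasisOneI.repr

theorem complexPlane_apply_zero (z : ℂ) : complexPlane z 0 = z.re := by
  simp [complexPlane]

theorem complexPlane_apply_one (z : ℂ) : complexPlane z 1 = z.im := by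
  simp [complexPlane]

theorem complexPlane_symm_ne_zero (w : PuncturedPlane) : complexPlane.symm w ≠ 0 := by
  rw [Ne, LinearIsometryEquiv.map_eq_zero_iff]
  exact w.2

theorem isPathConnected_compl_zero : IsPathConnected ({0}ᶜ : Set Plane) :=
  isPathConnected_compl_singleton_of_one_lt_rank (by
    rw [← Module.finrank_eq_rank, finrank_euclideanSpace_fin]
    norm_num) 0

instance : PathConnectedSpace PuncturedPlane :=
  isPathConnected_iff_pathConnectedSpace.mp isPathConnected_compl_zero

/-- The exponential as a map to the punctured plane. -/
noncomputable def expPlane : C(ℂ, PuncturedPlane) where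
  toFun z := ⟨complexPlane (Complex.exp z), by simp⟩
  continuous_toFun := by
    refine Continuous.subtype_mk ?_ _
    exact complexPlane.continuous.comp Complex.continuous_exp

/-- The loop that turns once around the origin, starting at a given point. -/
noncomputable def circleLoop (w : PuncturedPlane) : Path w w where
  toFun t := ⟨complexPlane (complexPlane.symm w * Complex.exp (2 * Real.pi * Complex.I * (t : ℝ))),
    by simpa using complexPlane_symm_ne_zero w⟩
  continuous_toFun := by
    refine Continuous.subtype_mk ?_ _
    exact complexPlane.continuous.comp (by fun_prop)
  source' := by simp
  target' := by simp

theorem circleLoop_norm (w : PuncturedPlane) (t : I) :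
    ‖(circleLoop w t : Plane)‖ = ‖(w : Plane)‖ := by
  simp [circleLoop, Complex.norm_exp]

theorem exists_expPlane_lift (γ : C(I, PuncturedPlane)) {z : ℂ} (hz : expPlane z = γ 0) :
    ∃ Γ : C(I, ℂ), Γ 0 = z ∧ ∀ t, expPlane (Γ t) = γ t := by
  let γ' : C(I, {z : ℂ // z ≠ 0}) :=
    ⟨fun t => ⟨complexPlane.symm (γ t), complexPlane_symm_ne_zero (γ t)⟩, by
      refine Continuous.subtype_mk ?_ _
      exact complexPlane.symm.continuous.comp (by fun_prop)⟩
  obtain ⟨Γ, h, h0⟩ := Complex.isCoveringMap_exp.exists_path_lifts γ' z (by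
    refine Subtype.ext ?_
    change complexPlane.symm (γ 0) = _
    rw [← hz]
    exact complexPlane.symm_apply_apply _)
  refine ⟨Γ, h0, fun t => Subtype.ext ?_⟩
  have := congrArg Subtype.val (congrFun h t)
  change Complex.exp (Γ t) = complexPlane.symm (γ t) at this
  change complexPlane (Complex.exp (Γ t)) = γ t
  rw [this, LinearIsometryEquiv.apply_symm_apply]

theorem zpowers_circleLoop (w : PuncturedPlane) :
    Subgroup.zpowers (FundamentalGroup.fromPath (Path.Homotopic.Quotient.mk (circleLoop w))) =
      ⊤ := by
  have hw := complexPlane_symm_ne_zero w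
  let z := Complex.log (complexPlane.symm w)
  have hz : Complex.exp z = complexPlane.symm w := Complex.exp_log hw
  have hz' : expPlane z = w := Subtype.ext (by
    change complexPlane (Complex.exp z) = w
    rw [hz, LinearIsometryEquiv.apply_symm_apply])
  let T : ℤ → ℂ := fun n => z + n * (2 * Real.pi * Complex.I)
  have hT : T 0 = z := by simp [T]
  let q : ∀ n, Path (T n) (T (n + 1)) := fun n =>
    { toFun := fun t => T n + 2 * Real.pi * Complex.I * (t : ℝ)
      continuous_toFun := by fun_prop
      source' := by simp
      target' := by simp [T]; ring }
  refine zpowers_eq_top_of_lifts expPlane (circleLoop w) T (fun γ => ?_)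
    (fun x hx => ?_) q fun n t => ?_
  · obtain ⟨Γ, h0, h⟩ := exists_expPlane_lift γ.toContinuousMap (z := z) (by simp [hz'])
    exact ⟨Γ, by rw [h0, hT], h⟩
  · have : Complex.exp x = Complex.exp z := by
      rw [hz]
      have := congrArg (fun u : PuncturedPlane => complexPlane.symm u) hx
      simpa [expPlane] using this
    obtain ⟨n, hn⟩ := Complex.exp_eq_exp_iff_exists_int.mp this
    exact ⟨n, hn.symm⟩
  · refine Subtype.ext ?_
    change complexPlane (Complex.exp (z + n * (2 * Real.pi * Complex.I) +
      2 * Real.pi * Complex.I * (t : ℝ))) = complexPlane (complexPlane.symm w * _)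
    rw [Complex.exp_add, Complex.exp_add, hz, Complex.exp_int_mul_two_pi_mul_I, mul_one]

end PuncturedPlane

/-! ### Charts of the circle and the crossing cocycle on the punctured torus -/

section Circle

/-- The point of the circle opposite to the origin. -/
noncomputable def halfPoint : UnitAddCircle := ((1 / 2 : ℝ) : UnitAddCircle)

/-- The representative of a point of the circle in `[0, 1)`. -/
noncomputable def circleRep (x : UnitAddCircle) : ℝ := (AddCircle.equivIco (1 : ℝ) 0 x : ℝ)

theorem circleRep_mem (x : UnitAddCircle) : circleRep x ∈ Set.Ico (0 : ℝ) 1 := by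
  have := (AddCircle.equivIco (1 : ℝ) 0 x).2
  exact ⟨this.1, this.2.trans_eq (zero_add _)⟩

theorem coe_circleRep (x : UnitAddCircle) : ((circleRep x : ℝ) : UnitAddCircle) = x :=
  AddCircle.coe_equivIco

theorem circleRep_coe {t : ℝ} (ht : t ∈ Set.Ico (0 : ℝ) 1) : circleRep (t : UnitAddCircle) = t :=
  AddCircle.equivIco_coe_of_mem (a := 0) (by rwa [zero_add])

theorem continuousAt_circleRep {x : UnitAddCircle} (hx : x ≠ 0) : ContinuousAt circleRep x :=
  continuousAt_subtype_val.comp (AddCircle.continuousAt_equivIco 1 0 (by simpa using hx))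

theorem coe_eq_coe_iff {s t : ℝ} : (s : UnitAddCircle) = t ↔ ∃ n : ℤ, s - t = n := by
  rw [← sub_eq_zero, ← AddCircle.coe_sub, AddCircle.coe_eq_zero_iff]
  simp [eq_comm]

theorem coe_ne_halfPoint {t : ℝ} (h : -1 / 2 < t) (h' : t < 1 / 2) :
    (t : UnitAddCircle) ≠ halfPoint := by
  rw [halfPoint, Ne, coe_eq_coe_iff]
  rintro ⟨n, hn⟩
  have h1 : (-1 : ℝ) < n := by linarith
  have h2 : (n : ℝ) < 0 := by linarith
  norm_cast at h1 h2
  lia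

theorem coe_ne_zero' {t : ℝ} (h : 0 < t) (h' : t < 1) : (t : UnitAddCircle) ≠ 0 := by
  rw [← AddCircle.coe_zero, Ne, coe_eq_coe_iff]
  rintro ⟨n, hn⟩
  have h1 : (0 : ℝ) < n := by linarith
  have h2 : (n : ℝ) < 1 := by linarith
  norm_cast at h1 h2
  lia

theorem zero_ne_halfPoint : (0 : UnitAddCircle) ≠ halfPoint := by
  rw [← AddCircle.coe_zero]
  exact coe_ne_halfPoint (by norm_num) (by norm_num)

theorem halfPoint_add_self : halfPoint + halfPoint = 0 := by
  rw [halfPoint, ← AddCircle.coe_add, ← AddCircle.coe_period (1 : ℝ)]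
  norm_num

/-- A chart of the circle around the point opposite to the origin. -/
noncomputable def circleChart (t : ℝ) : UnitAddCircle := (Real.sigmoid t : UnitAddCircle)

theorem sigmoid_mem (t : ℝ) : Real.sigmoid t ∈ Set.Ico (0 : ℝ) 1 :=
  ⟨Real.sigmoid_nonneg t, Real.sigmoid_lt_one t⟩

theorem circleRep_circleChart (t : ℝ) : circleRep (circleChart t) = Real.sigmoid t :=
  circleRep_coe (sigmoid_mem t)

theorem circleChart_zero : circleChart 0 = halfPoint := by
  simp [circleChart, halfPoint]

theorem circleChart_injective : Function.Injective circleChart := fun s t h => by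
  have := congrArg circleRep h
  rwa [circleRep_circleChart, circleRep_circleChart, Real.sigmoid_inj] at this

theorem isOpenEmbedding_circleChart : IsOpenEmbedding circleChart := by
  have h : IsOpenEmbedding Real.sigmoid :=
    ⟨Real.sigmoid_strictMono.isEmbedding_of_ordConnected (by
      rw [Real.range_sigmoid]; exact Set.ordConnected_Ioo), by
      rw [Real.range_sigmoid]; exact isOpen_Ioo⟩
  refine .of_continuous_injective_isOpenMap ?_ circleChart_injective ?_
  · exact (AddCircle.continuous_mk' (1 : ℝ)).comp h.continuous
  · exact (AddCircle.isLocalHomeomorph_coe (1 : ℝ)).isOpenMap.comp h.isOpenMap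

theorem range_circleChart : Set.range circleChart = {0}ᶜ := by
  ext x
  constructor
  · rintro ⟨t, rfl⟩
    exact coe_ne_zero' (Real.sigmoid_pos t) (Real.sigmoid_lt_one t)
  · intro hx
    have h0 : circleRep x ≠ 0 := fun h => hx (by
      rw [Set.mem_singleton_iff, ← coe_circleRep x, h, AddCircle.coe_zero])
    have : circleRep x ∈ Set.Ioo (0 : ℝ) 1 :=
      ⟨lt_of_le_of_ne (circleRep_mem x).1 h0.symm, (circleRep_mem x).2⟩
    rw [← Real.range_sigmoid] at this
    obtain ⟨t, ht⟩ := this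
    exact ⟨t, by rw [circleChart, ht, coe_circleRep]⟩

/-- A chart of the circle around the origin. -/
noncomputable def circleChart₀ (t : ℝ) : UnitAddCircle := circleChart t + halfPoint

theorem isOpenEmbedding_circleChart₀ : IsOpenEmbedding circleChart₀ :=
  (Homeomorph.addRight halfPoint).isOpenEmbedding.comp isOpenEmbedding_circleChart

theorem circleChart₀_zero : circleChart₀ 0 = 0 := by
  rw [circleChart₀, circleChart_zero, halfPoint_add_self]

theorem range_circleChart₀ : Set.range circleChart₀ = {halfPoint}ᶜ := by
  ext x
  have h : x ∈ Set.range circleChart₀ ↔ x - halfPoint ∈ Set.range circleChart := by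
    simp only [Set.mem_range, circleChart₀, eq_sub_iff_add_eq]
  rw [h, range_circleChart]
  simp [sub_eq_zero]

/-- The function on the circle that jumps from `1` to `g` at the half point. -/
noncomputable def jump {G : Type*} [Group G] (g : G) (x : UnitAddCircle) : G :=
  open Classical in if 1 / 2 < circleRep x then g else 1

theorem jump_circleChart_of_pos {G : Type*} [Group G] (g : G) {t : ℝ} (ht : 0 < t) :
    jump g (circleChart t) = g := by
  rw [jump, circleRep_circleChart, if_pos]
  have := Real.sigmoid_lt ht
  simpa using this

theorem jump_circleChart_of_neg {G : Type*} [Group G] (g : G) {t : ℝ} (ht : t < 0) :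
    jump g (circleChart t) = 1 := by
  rw [jump, circleRep_circleChart, if_neg]
  have := Real.sigmoid_lt ht
  simpa using this.le

/-- Away from `0` the representative in `[0, 1)` varies continuously, so by the intermediate value
theorem it cannot change sides without meeting `1 / 2`. -/
theorem jump_eq_of_path {G : Type*} [Group G] (g : G) (r : C(I, UnitAddCircle))
    (h0 : ∀ t, r t ≠ 0) (h1 : ∀ t, r t ≠ halfPoint) (s t : I) : jump g (r s) = jump g (r t) := by
  have hc : Continuous fun t => circleRep (r t) := continuous_iff_continuousAt.mpr fun t =>
    ContinuousAt.comp (g := circleRep) (continuousAt_circleRep (h0 t)) r.continuous.continuousAt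
  have hne : ∀ t, circleRep (r t) ≠ 1 / 2 := fun t h => h1 t (by
    rw [← coe_circleRep (r t), h, halfPoint])
  have key : ∀ s t, 1 / 2 < circleRep (r s) → 1 / 2 < circleRep (r t) := fun s t hs => by
    by_contra! ht
    obtain ⟨u, hu⟩ := mem_range_of_exists_le_of_exists_ge hc ⟨t, ht⟩ ⟨s, hs.le⟩
    exact hne u hu
  unfold jump
  congr 1
  exact propext ⟨key s t, key t s⟩

end Circle

section PuncturedTorus

/-- The torus without the point `(1/2, 1/2)`. -/
abbrev PuncturedTorus : Type := ({(halfPoint, halfPoint)}ᶜ : Set Torus)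

variable {G : Type*} [Group G]

/-- Three open sets that cover the punctured torus. -/
def torusCover : Fin 3 → Set PuncturedTorus :=
  ![{q | q.1.1 ≠ halfPoint ∧ q.1.2 ≠ halfPoint}, {q | q.1.1 ≠ 0 ∧ q.1.2 ≠ halfPoint},
    {q | q.1.1 ≠ halfPoint ∧ q.1.2 ≠ 0}]

/-- The functions that define a cocycle on the three open sets. -/
noncomputable def torusGauge (a b : G) : Fin 3 → PuncturedTorus → G :=
  ![fun _ => 1, fun q => jump a q.1.1, fun q => jump b q.1.2]

theorem isOpen_torusCover (i : Fin 3) : IsOpen (torusCover i) := by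
  have hx : ∀ c : UnitAddCircle, IsOpen {q : PuncturedTorus | q.1.1 ≠ c} := fun c =>
    isOpen_ne.preimage (continuous_fst.comp continuous_subtype_val)
  have hy : ∀ c : UnitAddCircle, IsOpen {q : PuncturedTorus | q.1.2 ≠ c} := fun c =>
    isOpen_ne.preimage (continuous_snd.comp continuous_subtype_val)
  fin_cases i
  · exact (hx _).inter (hy _)
  · exact (hx _).inter (hy _)
  · exact (hx _).inter (hy _)

theorem exists_mem_torusCover (q : PuncturedTorus) : ∃ i, q ∈ torusCover i := by
  have hq : ¬(q.1.1 = halfPoint ∧ q.1.2 = halfPoint) := fun h => q.2 (Prod.ext h.1 h.2)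
  by_cases hx : q.1.1 = halfPoint
  · exact ⟨1, by rw [hx]; exact zero_ne_halfPoint.symm, fun hy => hq ⟨hx, hy⟩⟩
  by_cases hy : q.1.2 = halfPoint
  · exact ⟨2, hx, by rw [hy]; exact zero_ne_halfPoint.symm⟩
  · exact ⟨0, hx, hy⟩

/-- The only crossing that the gauge of one set records is excluded by either of the other two sets.
-/
theorem torusGauge_eq (a b : G) {i j : Fin 3} (hij : i ≠ j) (r : C(I, PuncturedTorus))
    (hi : ∀ t, r t ∈ torusCover i) (hj : ∀ t, r t ∈ torusCover j) :
    torusGauge a b i (r 1) = torusGauge a b i (r 0) := by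
  fin_cases i
  · rfl
  · have h : ∀ t, (r t).1.1 ≠ halfPoint := fun t => by
      fin_cases j
      · exact (hj t).1
      · exact absurd rfl hij
      · exact (hj t).1
    exact jump_eq_of_path a ⟨fun t => (r t).1.1, by fun_prop⟩ (fun t => (hi t).1) h 1 0
  · have h : ∀ t, (r t).1.2 ≠ halfPoint := fun t => by
      fin_cases j
      · exact (hj t).2
      · exact (hj t).2
      · exact absurd rfl hij
    exact jump_eq_of_path b ⟨fun t => (r t).1.2, by fun_prop⟩ (fun t => (hi t).2) h 1 0

/-- On overlaps both gauges are constant along paths, so the three coboundaries are compatible and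
glue. The result records crossings of the circles through the puncture, with no relation between `a`
and `b`. -/
theorem exists_torusCocycle (a b : G) : ∃ F : PathCocycle PuncturedTorus G,
    ∀ i (r : C(I, PuncturedTorus)), (∀ t, r t ∈ torusCover i) →
      F.eval r = torusGauge a b i (r 1) * (torusGauge a b i (r 0))⁻¹ := by
  let F : ∀ i, PathCocycle (torusCover i) G := fun i =>
    PathCocycle.ofGauge fun q => torusGauge a b i q
  have hF : Compatible F := by
    intro i j r r' h
    by_cases hij : i = j
    · subst hij
      rw [ContinuousMap.ext fun t => Subtype.ext (h t)]
    · have e₁ := torusGauge_eq a b hij ((torusCover i).valMap.comp r) (fun t => (r t).2)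
        (fun t => by change (r t).1 ∈ _; rw [h t]; exact (r' t).2)
      have e₂ := torusGauge_eq a b (Ne.symm hij) ((torusCover j).valMap.comp r')
        (fun t => (r' t).2) (fun t => by change (r' t).1 ∈ _; rw [← h t]; exact (r t).2)
      change torusGauge a b i (r 1) * (torusGauge a b i (r 0))⁻¹ =
        torusGauge a b j (r' 1) * (torusGauge a b j (r' 0))⁻¹
      change torusGauge a b i (r 1) = torusGauge a b i (r 0) at e₁
      change torusGauge a b j (r' 1) = torusGauge a b j (r' 0) at e₂
      rw [e₁, e₂, mul_inv_cancel, mul_inv_cancel]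
  obtain ⟨Φ, hΦ⟩ := exists_glue isOpen_torusCover exists_mem_torusCover hF
  exact ⟨Φ, fun i r hr => hΦ i ⟨fun t => ⟨r t, hr t⟩, by fun_prop⟩⟩

end PuncturedTorus

/-! ### Values of the crossing cocycle on the coordinate loops and around the puncture -/

section Along

variable {X G : Type*} [TopologicalSpace X] [Group G]

/-- The affine parametrization of the segment from `s` to `t`. -/
def segMap (s t : ℝ) : C(I, ℝ) := ⟨fun u => s + u * (t - s), by fun_prop⟩

theorem segMap_mem {s t : ℝ} (h : s ≤ t) (u : I) : segMap s t u ∈ Set.Icc s t := by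
  have h0 := u.2.1
  have h1 := u.2.2
  constructor
  · change s ≤ s + u * (t - s)
    nlinarith
  · change s + u * (t - s) ≤ t
    nlinarith

/-- The value of a cocycle on the part of a curve between two parameters. -/
def PathCocycle.along (F : PathCocycle X G) (c : C(ℝ, X)) (s t : ℝ) : G :=
  F.eval (c.comp (segMap s t))

theorem PathCocycle.along_mul (F : PathCocycle X G) (c : C(ℝ, X)) (s t u : ℝ) :
    F.along c t u * F.along c s t = F.along c s u := by
  obtain ⟨k, hk⟩ := (F.comap c).exists_gauge
  have key : ∀ s t, F.along c s t * k s = k t := fun s t => by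
    have := hk (segMap s t).asPath
    simp only [segMap, ContinuousMap.coe_mk, Set.Icc.coe_zero, Set.Icc.coe_one, zero_mul, one_mul,
      add_zero, add_sub_cancel] at this
    rw [← this]
    congr 1
  have h := key s u
  rw [← key t u, ← key s t, ← mul_assoc, mul_left_inj] at h
  exact h.symm

theorem PathCocycle.val_eq_along (F : PathCocycle X G) (c : C(ℝ, X)) {x y : X} (p : Path x y)
    (h : ∀ t : I, p t = c t) : F.val p = F.along c 0 1 :=
  F.val_eq_eval _ _ fun t => by simp [h, segMap]

theorem PathCocycle.hom_bijective_of_path (F : PathCocycle X G) {x y : X} (p : Path x y)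
    (h : Function.Bijective (F.hom x)) : Function.Bijective (F.hom y) := by
  let e := FundamentalGroup.fundamentalGroupMulEquivOfPath p
  have he : ∀ γ, F.hom y (e γ) = MulAut.conj (F.val p) (F.hom x γ) := by
    rintro ⟨q⟩
    change F.val (p.symm.trans (q.trans p)) = F.val p * F.val q * (F.val p)⁻¹
    rw [F.val_trans, F.val_trans, F.val_symm]
  have : ⇑(F.hom y) = MulAut.conj (F.val p) ∘ F.hom x ∘ e.symm := by
    ext γ
    simp only [Function.comp_apply]
    rw [← he, MulEquiv.apply_symm_apply]
  rw [this]
  exact (MulEquiv.bijective _).comp (h.comp e.symm.bijective)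

end Along

section TorusGenerators

/-- The base point of the punctured torus. -/
def torusBase : PuncturedTorus := ⟨(0, 0), fun h => zero_ne_halfPoint (congrArg Prod.fst h)⟩

/-- The curve that winds around the torus in the first direction. -/
noncomputable def torusCurve₁ : C(ℝ, PuncturedTorus) :=
  ⟨fun t => ⟨((t : UnitAddCircle), 0), fun h => zero_ne_halfPoint (congrArg Prod.snd h)⟩,
    (((AddCircle.continuous_mk' (1 : ℝ))).prodMk continuous_const).subtype_mk _⟩

/-- The curve that winds around the torus in the second direction. -/
noncomputable def torusCurve₂ : C(ℝ, PuncturedTorus) :=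
  ⟨fun t => ⟨(0, (t : UnitAddCircle)), fun h => zero_ne_halfPoint (congrArg Prod.fst h)⟩,
    (continuous_const.prodMk ((AddCircle.continuous_mk' (1 : ℝ)))).subtype_mk _⟩

/-- The loop that winds once around the torus in the first direction. -/
noncomputable def torusLoop₁ : Path torusBase torusBase where
  toFun t := torusCurve₁ t
  continuous_toFun := by fun_prop
  source' := Subtype.ext (Prod.ext (AddCircle.coe_zero (1 : ℝ)) rfl)
  target' := Subtype.ext (Prod.ext (AddCircle.coe_period (1 : ℝ)) rfl)

/-- The loop that winds once around the torus in the second direction. -/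
noncomputable def torusLoop₂ : Path torusBase torusBase where
  toFun t := torusCurve₂ t
  continuous_toFun := by fun_prop
  source' := Subtype.ext (Prod.ext rfl (AddCircle.coe_zero (1 : ℝ)))
  target' := Subtype.ext (Prod.ext rfl (AddCircle.coe_period (1 : ℝ)))

variable {G : Type*} [Group G] {a b : G} {F : PathCocycle PuncturedTorus G}

theorem along_of_torusCover
    (hF : ∀ i (r : C(I, PuncturedTorus)), (∀ t, r t ∈ torusCover i) →
      F.eval r = torusGauge a b i (r 1) * (torusGauge a b i (r 0))⁻¹)
    (c : C(ℝ, PuncturedTorus)) (i : Fin 3) {s t : ℝ} (hst : s ≤ t)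
    (h : ∀ u ∈ Set.Icc s t, c u ∈ torusCover i) :
    F.along c s t = torusGauge a b i (c t) * (torusGauge a b i (c s))⁻¹ := by
  rw [PathCocycle.along, hF i _ fun u => h _ (segMap_mem hst u)]
  simp [segMap]

theorem coe_ne_halfPoint_of_gt {t : ℝ} (h : 1 / 2 < t) (h' : t < 3 / 2) :
    (t : UnitAddCircle) ≠ halfPoint := by
  have : (t : UnitAddCircle) = ((t - 1 : ℝ) : UnitAddCircle) := by
    rw [coe_eq_coe_iff]
    exact ⟨1, by push_cast; ring⟩
  rw [this]
  exact coe_ne_halfPoint (by linarith) (by linarith)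

theorem jump_coe_of_gt (g : G) {t : ℝ} (h : 1 / 2 < t) (h' : t < 1) :
    jump g (t : UnitAddCircle) = g := by
  rw [jump, circleRep_coe ⟨by linarith, h'⟩, if_pos h]

theorem jump_coe_of_le (g : G) {t : ℝ} (h : 0 ≤ t) (h' : t ≤ 1 / 2) :
    jump g (t : UnitAddCircle) = 1 := by
  rw [jump, circleRep_coe ⟨h, by linarith⟩, if_neg (by linarith)]

/-- Only the stretch from `1 / 4` to `3 / 4` crosses `x = 1 / 2`; on the outer stretches the gauge
is trivial. -/
theorem val_torusLoop₁
    (hF : ∀ i (r : C(I, PuncturedTorus)), (∀ t, r t ∈ torusCover i) →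
      F.eval r = torusGauge a b i (r 1) * (torusGauge a b i (r 0))⁻¹) :
    F.val torusLoop₁ = a := by
  rw [F.val_eq_along torusCurve₁ _ fun t => rfl,
    ← F.along_mul _ 0 (1 / 4) 1, ← F.along_mul _ (1 / 4) (3 / 4) 1,
    along_of_torusCover hF _ 0 (by norm_num : (0 : ℝ) ≤ 1 / 4) (fun u hu =>
      ⟨coe_ne_halfPoint (by linarith [hu.1]) (by linarith [hu.2]), zero_ne_halfPoint⟩),
    along_of_torusCover hF _ 1 (by norm_num : (1 / 4 : ℝ) ≤ 3 / 4) (fun u hu =>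
      ⟨coe_ne_zero' (by linarith [hu.1]) (by linarith [hu.2]), zero_ne_halfPoint⟩),
    along_of_torusCover hF _ 0 (by norm_num : (3 / 4 : ℝ) ≤ 1) (fun u hu =>
      ⟨coe_ne_halfPoint_of_gt (by linarith [hu.1]) (by linarith [hu.2]), zero_ne_halfPoint⟩)]
  have h1 : torusGauge a b 1 (torusCurve₁ (3 / 4)) = a :=
    jump_coe_of_gt a (by norm_num) (by norm_num)
  have h2 : torusGauge a b 1 (torusCurve₁ (1 / 4)) = 1 :=
    jump_coe_of_le a (by norm_num) (by norm_num)
  rw [h1, h2]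
  simp [torusGauge]

theorem val_torusLoop₂
    (hF : ∀ i (r : C(I, PuncturedTorus)), (∀ t, r t ∈ torusCover i) →
      F.eval r = torusGauge a b i (r 1) * (torusGauge a b i (r 0))⁻¹) :
    F.val torusLoop₂ = b := by
  rw [F.val_eq_along torusCurve₂ _ fun t => rfl,
    ← F.along_mul _ 0 (1 / 4) 1, ← F.along_mul _ (1 / 4) (3 / 4) 1,
    along_of_torusCover hF _ 0 (by norm_num : (0 : ℝ) ≤ 1 / 4) (fun u hu =>
      ⟨zero_ne_halfPoint, coe_ne_halfPoint (by linarith [hu.1]) (by linarith [hu.2])⟩),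
    along_of_torusCover hF _ 2 (by norm_num : (1 / 4 : ℝ) ≤ 3 / 4) (fun u hu =>
      ⟨zero_ne_halfPoint, coe_ne_zero' (by linarith [hu.1]) (by linarith [hu.2])⟩),
    along_of_torusCover hF _ 0 (by norm_num : (3 / 4 : ℝ) ≤ 1) (fun u hu =>
      ⟨zero_ne_halfPoint, coe_ne_halfPoint_of_gt (by linarith [hu.1]) (by linarith [hu.2])⟩)]
  have h1 : torusGauge a b 2 (torusCurve₂ (3 / 4)) = b :=
    jump_coe_of_gt b (by norm_num) (by norm_num)
  have h2 : torusGauge a b 2 (torusCurve₂ (1 / 4)) = 1 :=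
    jump_coe_of_le b (by norm_num) (by norm_num)
  rw [h1, h2]
  simp [torusGauge]

end TorusGenerators

section TorusChart

/-- A chart of the torus around the point `(1/2, 1/2)`. -/
noncomputable def torusChart (z : Plane) : Torus := (circleChart (z 0), circleChart (z 1))

theorem isOpenEmbedding_torusChart : IsOpenEmbedding torusChart := by
  have h := (isOpenEmbedding_circleChart.prodMap isOpenEmbedding_circleChart).comp
    (((EuclideanSpace.equiv (Fin 2) ℝ).toHomeomorph.trans
      (Homeomorph.finTwoArrow (X := ℝ))).isOpenEmbedding)
  exact h

theorem torusChart_zero : torusChart 0 = (halfPoint, halfPoint) := by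
  simp [torusChart, circleChart_zero]

/-- The chart on the punctured plane. -/
noncomputable def puncturedTorusChart : C(PuncturedPlane, PuncturedTorus) :=
  ⟨fun z => ⟨torusChart z, fun h => z.2 (isOpenEmbedding_torusChart.injective
    (h.trans torusChart_zero.symm))⟩,
    (isOpenEmbedding_torusChart.continuous.comp continuous_subtype_val).subtype_mk _⟩

/-- The point of the unit circle with the given angle. -/
noncomputable def unitCirclePoint (θ : ℝ) : PuncturedPlane := expPlane (θ * Complex.I)

theorem unitCirclePoint_zero (θ : ℝ) : (unitCirclePoint θ : Plane) 0 = Real.cos θ := by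
  rw [unitCirclePoint, expPlane]
  exact (complexPlane_apply_zero _).trans (Complex.exp_ofReal_mul_I_re θ)

theorem unitCirclePoint_one (θ : ℝ) : (unitCirclePoint θ : Plane) 1 = Real.sin θ := by
  rw [unitCirclePoint, expPlane]
  exact (complexPlane_apply_one _).trans (Complex.exp_ofReal_mul_I_im θ)

theorem circleLoop_unitCirclePoint (θ : ℝ) (t : I) :
    circleLoop (unitCirclePoint θ) t = unitCirclePoint (θ + 2 * Real.pi * t) := by
  refine Subtype.ext ?_
  change complexPlane (complexPlane.symm (complexPlane (Complex.exp (θ * Complex.I))) * _) =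
    complexPlane (Complex.exp _)
  rw [LinearIsometryEquiv.symm_apply_apply, ← Complex.exp_add]
  push_cast
  ring_nf

/-- The curve on the torus that winds around the puncture. -/
noncomputable def boundaryCurve : C(ℝ, PuncturedTorus) :=
  puncturedTorusChart.comp ⟨unitCirclePoint, by
    exact expPlane.continuous.comp (by fun_prop)⟩

variable {G : Type*} [Group G] {a b : G} {F : PathCocycle PuncturedTorus G}

theorem circleChart_ne_halfPoint {t : ℝ} (ht : t ≠ 0) : circleChart t ≠ halfPoint := fun h =>
  ht (circleChart_injective (h.trans circleChart_zero.symm))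

theorem circleChart_ne_zero (t : ℝ) : circleChart t ≠ 0 := by
  have : circleChart t ∈ Set.range circleChart := ⟨t, rfl⟩
  rwa [range_circleChart] at this

theorem boundaryCurve_fst (θ : ℝ) : (boundaryCurve θ).1.1 = circleChart (Real.cos θ) := by
  rw [← unitCirclePoint_zero]
  rfl

theorem boundaryCurve_snd (θ : ℝ) : (boundaryCurve θ).1.2 = circleChart (Real.sin θ) := by
  rw [← unitCirclePoint_one]
  rfl

/-- Starting at angle `-π / 4`, the circle crosses the four half axes in turn, reading `b`, `a⁻¹`,
`b⁻¹`, `a`. Later letters stand to the left by the convention for concatenation. -/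
theorem val_boundaryLoop
    (hF : ∀ i (r : C(I, PuncturedTorus)), (∀ t, r t ∈ torusCover i) →
      F.eval r = torusGauge a b i (r 1) * (torusGauge a b i (r 0))⁻¹) :
    F.val ((circleLoop (unitCirclePoint (-(Real.pi / 4)))).map puncturedTorusChart.continuous) =
      a * b⁻¹ * a⁻¹ * b := by
  have hπ := Real.pi_pos
  let π := Real.pi
  have h₁ : F.val ((circleLoop (unitCirclePoint (-(π / 4)))).map puncturedTorusChart.continuous) =
      F.along boundaryCurve (-(π / 4)) (7 * π / 4) := by
    refine F.val_eq_eval _ _ fun t => ?_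
    change puncturedTorusChart (circleLoop _ t) = puncturedTorusChart (unitCirclePoint _)
    rw [circleLoop_unitCirclePoint]
    congr 2
    change _ = -(π / 4) + t * (7 * π / 4 - -(π / 4))
    ring
  have cover₁ : ∀ θ, Real.sin θ ≠ 0 → boundaryCurve θ ∈ torusCover 1 := fun θ h =>
    ⟨by rw [boundaryCurve_fst]; exact circleChart_ne_zero _,
     by rw [boundaryCurve_snd]; exact circleChart_ne_halfPoint h⟩
  have cover₂ : ∀ θ, Real.cos θ ≠ 0 → boundaryCurve θ ∈ torusCover 2 := fun θ h =>
    ⟨by rw [boundaryCurve_fst]; exact circleChart_ne_halfPoint h,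
     by rw [boundaryCurve_snd]; exact circleChart_ne_zero _⟩
  have c₁ : ∀ θ ∈ Set.Icc (-(π / 4)) (π / 4), 0 < Real.cos θ := fun θ h =>
    Real.cos_pos_of_mem_Ioo ⟨by linarith [h.1], by linarith [h.2]⟩
  have c₂ : ∀ θ ∈ Set.Icc (π / 4) (3 * π / 4), 0 < Real.sin θ := fun θ h =>
    Real.sin_pos_of_pos_of_lt_pi (by linarith [h.1]) (by linarith [h.2])
  have c₃ : ∀ θ ∈ Set.Icc (3 * π / 4) (5 * π / 4), Real.cos θ < 0 := fun θ h =>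
    Real.cos_neg_of_pi_div_two_lt_of_lt (by linarith [h.1]) (by linarith [h.2])
  have c₄ : ∀ θ ∈ Set.Icc (5 * π / 4) (7 * π / 4), Real.sin θ < 0 := fun θ h => by
    have := Real.sin_pos_of_pos_of_lt_pi (x := θ - π) (by linarith [h.1]) (by linarith [h.2])
    rw [Real.sin_sub_pi] at this
    linarith
  have c₀ : Real.sin (-(π / 4)) < 0 := Real.sin_neg_of_neg_of_neg_pi_lt (by linarith) (by linarith)
  have c₅ : 0 < Real.cos (7 * π / 4) := by
    have := Real.cos_pos_of_mem_Ioo (x := 7 * π / 4 - 2 * π) ⟨by linarith, by linarith⟩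
    rwa [Real.cos_sub_two_pi] at this
  have g₁ : ∀ θ, torusGauge a b 1 (boundaryCurve θ) = jump a (circleChart (Real.cos θ)) :=
    fun θ => congrArg (jump a) (boundaryCurve_fst θ)
  have g₂ : ∀ θ, torusGauge a b 2 (boundaryCurve θ) = jump b (circleChart (Real.sin θ)) :=
    fun θ => congrArg (jump b) (boundaryCurve_snd θ)
  -- The odd multiples of `π / 4` cut the circle into four arcs, on each of which one of `cos`,
  -- `sin` has constant sign; each arc lies in one set of the cover.
  rw [h₁, ← F.along_mul _ _ (π / 4), ← F.along_mul _ (π / 4) (3 * π / 4),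
    ← F.along_mul _ (3 * π / 4) (5 * π / 4),
    along_of_torusCover hF _ 2 (by linarith) fun θ h => cover₂ θ (c₁ θ h).ne',
    along_of_torusCover hF _ 1 (by linarith) fun θ h => cover₁ θ (c₂ θ h).ne',
    along_of_torusCover hF _ 2 (by linarith) fun θ h => cover₂ θ (c₃ θ h).ne,
    along_of_torusCover hF _ 1 (by linarith) fun θ h => cover₁ θ (c₄ θ h).ne]
  simp only [g₁, g₂]
  rw [jump_circleChart_of_neg b c₀, jump_circleChart_of_pos a c₅,
    jump_circleChart_of_pos b (c₂ (π / 4) ⟨le_rfl, by linarith⟩),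
    jump_circleChart_of_pos b (c₂ (3 * π / 4) ⟨by linarith, le_rfl⟩),
    jump_circleChart_of_neg b (c₄ (5 * π / 4) ⟨le_rfl, by linarith⟩),
    jump_circleChart_of_pos a (c₁ (π / 4) ⟨by linarith, le_rfl⟩),
    jump_circleChart_of_neg a (c₃ (3 * π / 4) ⟨le_rfl, by linarith⟩),
    jump_circleChart_of_neg a (c₃ (5 * π / 4) ⟨by linarith, le_rfl⟩)]
  group

end TorusChart

theorem Topology.IsEmbedding.exists_lift {X Y Z : Type*} [TopologicalSpace X] [TopologicalSpace Y]
    [TopologicalSpace Z] {f : Y → X} (hf : IsEmbedding f) (γ : C(Z, X))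
    (h : ∀ t, γ t ∈ Set.range f) : ∃ γ' : C(Z, Y), ∀ t, f (γ' t) = γ t := by
  choose g hg using h
  refine ⟨⟨g, hf.continuous_iff.mpr ?_⟩, hg⟩
  have : f ∘ g = γ := funext hg
  rw [this]
  exact γ.continuous

theorem FundamentalGroup.map_eq_of_zpowers {X Y G : Type*} [TopologicalSpace X] [TopologicalSpace Y]
    [Group G] {y : Y} {f : C(Y, X)} {h h' : FundamentalGroup X (f y) →* G} (r : Path y y)
    (hr : Subgroup.zpowers (FundamentalGroup.fromPath (Path.Homotopic.Quotient.mk r)) = ⊤)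
    (e : h (FundamentalGroup.fromPath (Path.Homotopic.Quotient.mk (r.map f.continuous))) =
      h' (FundamentalGroup.fromPath (Path.Homotopic.Quotient.mk (r.map f.continuous))))
    (γ : FundamentalGroup Y y) :
    h (FundamentalGroup.map f y γ) = h' (FundamentalGroup.map f y γ) := by
  have hγ : γ ∈ Subgroup.zpowers (FundamentalGroup.fromPath (Path.Homotopic.Quotient.mk r)) :=
    hr ▸ Subgroup.mem_top γ
  obtain ⟨n, rfl⟩ := hγ
  simp only [map_zpow]
  exact congrArg (· ^ n) e

/-! ### The fundamental group of the punctured torus is free -/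

section Cylinder

/-- Here `ψ` displays `B` as circle times open arc, and the plane maps onto it. A loop lifts
coordinatewise, by the covering of the circle and by the chart of the arc; the fiber over the base
point is `ℤ × {0}`. -/
theorem zpowers_cylinder {B : Type*} [TopologicalSpace B] {ψ : B → Torus} (hψ : Continuous ψ)
    (hinj : Function.Injective ψ) (hB : ∀ b, (ψ b).2 ≠ halfPoint) (p : C(ℝ × ℝ, B))
    (hp : ∀ s, ψ (p s) = ((s.1 : UnitAddCircle), circleChart₀ s.2)) {b : B} (r : Path b b)
    (hr : ∀ t : I, ψ (r t) = (((t : ℝ) : UnitAddCircle), 0)) :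
    Subgroup.zpowers (FundamentalGroup.fromPath (Path.Homotopic.Quotient.mk r)) = ⊤ := by
  have hB' : ∀ b, (ψ b).2 ∈ Set.range circleChart₀ := fun b => by
    rw [range_circleChart₀]
    exact hB b
  have hsurj : Function.Surjective p := fun x => by
    obtain ⟨t, ht⟩ := hB' x
    refine ⟨(circleRep (ψ x).1, t), hinj ?_⟩
    rw [hp, coe_circleRep, ht]
  have : PathConnectedSpace B := hsurj.pathConnectedSpace p.continuous
  have hb : ψ b = (0, 0) := by
    have := hr 0
    rwa [r.source, Set.Icc.coe_zero, AddCircle.coe_zero] at this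
  let T : ℤ → ℝ × ℝ := fun n => (n, 0)
  let q : ∀ n, Path (T n) (T (n + 1)) := fun n =>
    { toFun := fun t => (n + t, 0)
      continuous_toFun := by fun_prop
      source' := by simp [T]
      target' := by simp [T] }
  refine zpowers_eq_top_of_lifts p r T (fun γ => ?_) (fun x hx => ?_) q fun n t => hinj ?_
  · obtain ⟨Γ₁, h₁, h₁'⟩ := (AddCircle.isCoveringMap_coe (1 : ℝ)).exists_path_lifts
      ⟨fun t => (ψ (γ t)).1, by fun_prop⟩ 0 (by simp [hb])
    obtain ⟨Γ₂, h₂⟩ := isOpenEmbedding_circleChart₀.isEmbedding.exists_lift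
      ⟨fun t => (ψ (γ t)).2, by fun_prop⟩ fun t => hB' (γ t)
    refine ⟨⟨fun t => (Γ₁ t, Γ₂ t), by fun_prop⟩, ?_, fun t => hinj ?_⟩
    · refine Prod.ext (by simpa [T] using h₁') (isOpenEmbedding_circleChart₀.injective ?_)
      change circleChart₀ (Γ₂ 0) = circleChart₀ 0
      rw [h₂, circleChart₀_zero]
      simp [hb]
    · rw [hp]
      exact Prod.ext (congrFun h₁ t) (h₂ t)
  · have h := hp x
    rw [hx, hb, Prod.mk.injEq] at h
    obtain ⟨n, hn⟩ := AddCircle.coe_eq_zero_iff (1 : ℝ) |>.mp h.1.symm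
    refine ⟨n, Prod.ext (by simpa [T] using hn) (isOpenEmbedding_circleChart₀.injective ?_)⟩
    change circleChart₀ 0 = _
    rw [circleChart₀_zero, ← h.2]
  · rw [hr, hp]
    refine Prod.ext ?_ circleChart₀_zero
    change ((n + t : ℝ) : UnitAddCircle) = _
    rw [coe_eq_coe_iff]
    exact ⟨n, by ring⟩

end Cylinder

section TorusUnique

theorem circleChart₀_ne (t : ℝ) : circleChart₀ t ≠ halfPoint := by
  have : circleChart₀ t ∈ Set.range circleChart₀ := ⟨t, rfl⟩
  rwa [range_circleChart₀] at this

theorem exists_circleChart₀ {x : UnitAddCircle} (hx : x ≠ halfPoint) :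
    ∃ t, circleChart₀ t = x := by
  have : x ∈ ({halfPoint}ᶜ : Set UnitAddCircle) := hx
  rwa [← range_circleChart₀] at this

/-- The points of the punctured torus whose first coordinate is not the half point. -/
def torusSet₁ : Set PuncturedTorus := {q | q.1.1 ≠ halfPoint}

/-- The points of the punctured torus whose second coordinate is not the half point. -/
def torusSet₂ : Set PuncturedTorus := {q | q.1.2 ≠ halfPoint}

theorem isOpen_torusSet₁ : IsOpen torusSet₁ :=
  isOpen_ne.preimage (continuous_fst.comp continuous_subtype_val)

theorem isOpen_torusSet₂ : IsOpen torusSet₂ :=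
  isOpen_ne.preimage (continuous_snd.comp continuous_subtype_val)

theorem torusSet_union : torusSet₁ ∪ torusSet₂ = Set.univ := by
  ext q
  simp only [Set.mem_union, Set.mem_univ, iff_true]
  by_contra! h
  exact q.2 (Prod.ext (not_not.mp h.1) (not_not.mp h.2))

/-- A parametrization of the first set. -/
noncomputable def torusMap₁ : C(ℝ × ℝ, torusSet₁) :=
  ⟨fun s => ⟨⟨(circleChart₀ s.2, s.1), fun h => circleChart₀_ne _ (congrArg Prod.fst h)⟩,
    circleChart₀_ne _⟩, by
    refine (Continuous.subtype_mk (.prodMk ?_ ?_) _).subtype_mk _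
    · exact isOpenEmbedding_circleChart₀.continuous.comp continuous_snd
    · exact (AddCircle.continuous_mk' (1 : ℝ)).comp continuous_fst⟩

/-- A parametrization of the second set. -/
noncomputable def torusMap₂ : C(ℝ × ℝ, torusSet₂) :=
  ⟨fun s => ⟨⟨(s.1, circleChart₀ s.2), fun h => circleChart₀_ne _ (congrArg Prod.snd h)⟩,
    circleChart₀_ne _⟩, by
    refine (Continuous.subtype_mk (.prodMk ?_ ?_) _).subtype_mk _
    · exact (AddCircle.continuous_mk' (1 : ℝ)).comp continuous_fst
    · exact isOpenEmbedding_circleChart₀.continuous.comp continuous_snd⟩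

theorem isPathConnected_torusSet₁ : IsPathConnected torusSet₁ := by
  have hs : Function.Surjective torusMap₁ := by
    rintro ⟨⟨⟨x, y⟩, h⟩, h'⟩
    obtain ⟨t, rfl⟩ := exists_circleChart₀ h'
    exact ⟨(circleRep y, t), Subtype.ext (Subtype.ext (Prod.ext rfl (coe_circleRep y)))⟩
  exact isPathConnected_iff_pathConnectedSpace.mpr (hs.pathConnectedSpace torusMap₁.continuous)

theorem isPathConnected_torusSet₂ : IsPathConnected torusSet₂ := by
  have hs : Function.Surjective torusMap₂ := by
    rintro ⟨⟨⟨x, y⟩, h⟩, h'⟩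
    obtain ⟨t, rfl⟩ := exists_circleChart₀ h'
    exact ⟨(circleRep x, t), Subtype.ext (Subtype.ext (Prod.ext (coe_circleRep x) rfl))⟩
  exact isPathConnected_iff_pathConnectedSpace.mpr (hs.pathConnectedSpace torusMap₂.continuous)

theorem isPathConnected_torusSet_inter : IsPathConnected (torusSet₁ ∩ torusSet₂) := by
  have hc : Continuous fun s : ℝ × ℝ => (⟨(circleChart₀ s.1, circleChart₀ s.2), fun h =>
      circleChart₀_ne _ (congrArg Prod.fst h)⟩ : PuncturedTorus) := by
    refine Continuous.subtype_mk (.prodMk ?_ ?_) _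
    · exact isOpenEmbedding_circleChart₀.continuous.comp continuous_fst
    · exact isOpenEmbedding_circleChart₀.continuous.comp continuous_snd
  convert isPathConnected_range hc
  ext q
  constructor
  · intro h
    obtain ⟨s, hs⟩ := exists_circleChart₀ h.1
    obtain ⟨t, ht⟩ := exists_circleChart₀ h.2
    exact ⟨(s, t), Subtype.ext (Prod.ext hs ht)⟩
  · rintro ⟨s, rfl⟩
    exact ⟨circleChart₀_ne _, circleChart₀_ne _⟩

instance : PathConnectedSpace PuncturedTorus := by
  rw [pathConnectedSpace_iff_univ, ← torusSet_union]
  exact isPathConnected_torusSet₁.union isPathConnected_torusSet₂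
    isPathConnected_torusSet_inter.nonempty

theorem torusBase_mem : torusBase ∈ torusSet₁ ∩ torusSet₂ := ⟨zero_ne_halfPoint, zero_ne_halfPoint⟩

/-- The complements of the two circles through the puncture are cylinders, each with cyclic group
generated by one coordinate loop, and together they cover. Hence the two loops generate. -/
theorem torus_hom_ext {G : Type*} [Group G] {h h' : FundamentalGroup PuncturedTorus torusBase →* G}
    (h₁ : h (FundamentalGroup.fromPath (Path.Homotopic.Quotient.mk torusLoop₁)) =
      h' (FundamentalGroup.fromPath (Path.Homotopic.Quotient.mk torusLoop₁)))
    (h₂ : h (FundamentalGroup.fromPath (Path.Homotopic.Quotient.mk torusLoop₂)) =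
      h' (FundamentalGroup.fromPath (Path.Homotopic.Quotient.mk torusLoop₂))) : h = h' := by
  refine vanKampen_unique isOpen_torusSet₁ isOpen_torusSet₂ torusSet_union
    isPathConnected_torusSet₁ isPathConnected_torusSet₂ isPathConnected_torusSet_inter
    torusBase_mem (fun γ => ?_) fun γ => ?_
  · let r := torusLoop₂.codRestrict (U := torusSet₁) fun t => zero_ne_halfPoint
    refine FundamentalGroup.map_eq_of_zpowers (f := torusSet₁.valMap) r ?_ h₂ γ
    refine zpowers_cylinder (ψ := fun q => q.1.1.swap) (by fun_prop) (fun q q' h => ?_)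
      (fun q => q.2) torusMap₁ (fun s => rfl) r fun t => rfl
    exact Subtype.ext (Subtype.ext (Prod.swap_injective h))
  · let r := torusLoop₁.codRestrict (U := torusSet₂) fun t => zero_ne_halfPoint
    refine FundamentalGroup.map_eq_of_zpowers (f := torusSet₂.valMap) r ?_ h₁ γ
    refine zpowers_cylinder (ψ := fun q => q.1.1) (by fun_prop) (fun q q' h => ?_)
      (fun q => q.2) torusMap₂ (fun s => rfl) r fun t => rfl
    exact Subtype.ext (Subtype.ext h)

/-- The commutator of the two generators of the free group. -/
def freeCommutator : FreeGroup Bool :=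
  .of true * .of false * (.of true)⁻¹ * (.of false)⁻¹

/-- The crossing cocycle and the map from the free group to loops are mutually inverse: one
composite is checked on letters, the other on the two generating loops. -/
theorem exists_torus_cocycle_bijective : ∃ F : PathCocycle PuncturedTorus (FreeGroup Bool),
    (∀ x, Function.Bijective (F.hom x)) ∧
    F.val ((circleLoop (unitCirclePoint (-(Real.pi / 4)))).map puncturedTorusChart.continuous) =
      freeCommutator := by
  -- Taking the second letter inverted turns the boundary word `a * b⁻¹ * a⁻¹ * b` into exactly
  -- `freeCommutator`.
  obtain ⟨F, hF⟩ := exists_torusCocycle (FreeGroup.of true) (FreeGroup.of false)⁻¹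
  refine ⟨F, fun x => ?_, ?_⟩
  · refine F.hom_bijective_of_path (PathConnectedSpace.somePath torusBase x) ?_
    let γ : Bool → FundamentalGroup PuncturedTorus torusBase := fun b =>
      cond b (FundamentalGroup.fromPath (Path.Homotopic.Quotient.mk torusLoop₁))
        (FundamentalGroup.fromPath (Path.Homotopic.Quotient.mk torusLoop₂))⁻¹
    have h₁ : F.hom torusBase (FundamentalGroup.fromPath (Path.Homotopic.Quotient.mk torusLoop₁)) =
        FreeGroup.of true := val_torusLoop₁ hF
    have h₂ : F.hom torusBase (FundamentalGroup.fromPath (Path.Homotopic.Quotient.mk torusLoop₂)) =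
        (FreeGroup.of false)⁻¹ := val_torusLoop₂ hF
    have e₁ : (F.hom torusBase).comp (FreeGroup.lift γ) = MonoidHom.id _ := by
      ext b
      cases b
      · simp [γ, h₂]
      · simp [γ, h₁]
    have e₂ : (FreeGroup.lift γ).comp (F.hom torusBase) = MonoidHom.id _ := by
      refine torus_hom_ext ?_ ?_
      · simp [γ, h₁]
      · simp [γ, h₂]
    exact Function.bijective_iff_has_inverse.mpr
      ⟨FreeGroup.lift γ, DFunLike.congr_fun e₂, DFunLike.congr_fun e₁⟩
  · rw [val_boundaryLoop hF, inv_inv, freeCommutator]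

end TorusUnique

/-! ### Independence of the chart around the puncture -/

section GroupLemmas

theorem eq_or_eq_inv_of_zpowers_eq {G : Type*} [Group G] [IsMulTorsionFree G] {x y : G}
    (h : Subgroup.zpowers x = Subgroup.zpowers y) : x = y ∨ x = y⁻¹ := by
  by_cases hx : x = 1
  · left
    have hy : y ∈ Subgroup.zpowers x := h ▸ Subgroup.mem_zpowers y
    rw [hx, Subgroup.zpowers_one_eq_bot, Subgroup.mem_bot] at hy
    rw [hx, hy]
  · rcases (Subgroup.zpowers_eq_zpowers_iff fun h => hx h.eq_one').mp h with
      h | h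
    · exact .inl h
    · right
      rw [← h, inv_inv]

/-- Free groups are torsion free, so a generator of the conjugated cyclic subgroup is the conjugated
commutator or its inverse. -/
theorem exists_freeGroup_mulEquiv {x : FreeGroup Bool} (u : FreeGroup Bool)
    (h : Subgroup.zpowers x = (Subgroup.zpowers freeCommutator).map (MulAut.conj u).toMonoidHom) :
    ∃ e : FreeGroup Bool ≃* FreeGroup Bool, e x = freeCommutator := by
  rw [MonoidHom.map_zpowers] at h
  rcases eq_or_eq_inv_of_zpowers_eq h with h | h
  · exact ⟨(MulAut.conj u).symm, by rw [h]; exact MulEquiv.symm_apply_apply _ _⟩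
  -- Exchanging the two letters inverts the commutator; this absorbs a reversal of orientation.
  · refine ⟨(MulAut.conj u).symm.trans (FreeGroup.freeGroupCongr Equiv.boolNot), ?_⟩
    rw [h, map_inv, MulEquiv.trans_apply]
    have : (MulAut.conj u).symm ((MulAut.conj u).toMonoidHom freeCommutator) = freeCommutator :=
      MulEquiv.symm_apply_apply _ _
    rw [this, freeCommutator]
    simp [mul_assoc]

end GroupLemmas

section Transport

variable {X Y : Type*} [TopologicalSpace X] [TopologicalSpace Y]

/-- A homeomorphism induces an isomorphism of fundamental groups. -/
noncomputable def Homeomorph.fundamentalGroupEquiv (H : X ≃ₜ Y) (x : X) :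
    FundamentalGroup X x ≃* FundamentalGroup Y (H x) :=
  haveI : (FundamentalGroupoid.map (H : C(X, Y))).IsEquivalence :=
    (FundamentalGroupoidFunctor.equivOfHomotopyEquiv H.toHomotopyEquiv).isEquivalence_functor
  (CategoryTheory.Functor.FullyFaithful.ofFullyFaithful
    (FundamentalGroupoid.map (H : C(X, Y)))).mulEquivEnd (FundamentalGroupoid.mk x)

theorem PathCocycle.range_hom_eq {G : Type*} [Group G] (F : PathCocycle X G) {x y : X}
    (p : Path x y) : (F.hom y).range = (F.hom x).range.map (MulAut.conj (F.val p)).toMonoidHom := by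
  ext g
  constructor
  · rintro ⟨⟨q⟩, rfl⟩
    refine ⟨F.val (p.trans (q.trans p.symm)), ⟨FundamentalGroup.fromPath
      (Path.Homotopic.Quotient.mk (p.trans (q.trans p.symm))), rfl⟩, ?_⟩
    change F.val p * F.val (p.trans (q.trans p.symm)) * (F.val p)⁻¹ = F.val q
    rw [F.val_trans, F.val_trans, F.val_symm]
    group
  · rintro ⟨-, ⟨⟨q⟩, rfl⟩, rfl⟩
    refine ⟨FundamentalGroup.fromPath
      (Path.Homotopic.Quotient.mk (p.symm.trans (q.trans p))), ?_⟩
    change F.val (p.symm.trans (q.trans p)) = F.val p * F.val q * (F.val p)⁻¹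
    rw [F.val_trans, F.val_trans, F.val_symm]

theorem PathCocycle.range_hom_of_zpowers {G : Type*} [Group G] (F : PathCocycle X G) {x : X}
    {g : FundamentalGroup X x} (hg : Subgroup.zpowers g = ⊤) :
    (F.hom x).range = Subgroup.zpowers (F.hom x g) := by
  rw [MonoidHom.range_eq_map, ← hg, MonoidHom.map_zpowers]

end Transport

section LocalLoop

variable {X G : Type*} [TopologicalSpace X] [Group G]

/-- An open embedding of the plane, restricted to the punctured plane. -/
def RegularBall.punctured (e : RegularBall 2 X) : C(PuncturedPlane, ({e.toFun 0}ᶜ : Set X)) :=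
  ⟨fun z => ⟨e.toFun z, fun h => z.2 (e.isOpenEmbedding.injective h)⟩,
    (e.isOpenEmbedding.continuous.comp continuous_subtype_val).subtype_mk _⟩

variable {p : X} (F : PathCocycle ({p}ᶜ : Set X) G)

/-- A round loop of the chart `e` that stays in the patch of `d` can be rewritten in the coordinates
of `d`, where it still avoids the center. -/
theorem val_circleLoop_mem_range {e d : RegularBall 2 X} {e' d' : C(PuncturedPlane, ({p}ᶜ : Set X))}
    (he : ∀ z, (e' z : X) = e.toFun z) (hd : ∀ z, (d' z : X) = d.toFun z) (hd₀ : d.toFun 0 = p)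
    {w v : PuncturedPlane} (hwv : e' w = d' v)
    (h : ∀ z : Plane, ‖z‖ = ‖(w : Plane)‖ → e.toFun z ∈ Set.range d.toFun) :
    (F.comap e').hom w (FundamentalGroup.fromPath (Path.Homotopic.Quotient.mk (circleLoop w))) ∈
      ((F.comap d').hom v).range := by
  obtain ⟨γ, hγ⟩ := d.isOpenEmbedding.isEmbedding.exists_lift
    ⟨fun t : I => e.toFun (circleLoop w t), e.isOpenEmbedding.continuous.comp (by fun_prop)⟩
    fun t => h _ (circleLoop_norm w t)
  have hne : ∀ t, γ t ≠ 0 := fun t h0 => (e' (circleLoop w t)).2 (by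
    rw [Set.mem_singleton_iff, he, ← hd₀]
    exact (hγ t).symm.trans (congrArg d.toFun h0))
  have hend : ∀ t, circleLoop w t = w → γ t = v := fun t ht => d.isOpenEmbedding.injective (by
    rw [← hd, ← hwv, he, ← ht]
    exact hγ t)
  let q : Path v v :=
    { toFun := fun t => ⟨γ t, hne t⟩
      continuous_toFun := by fun_prop
      source' := Subtype.ext (hend 0 (circleLoop w).source)
      target' := Subtype.ext (hend 1 (circleLoop w).target) }
  refine ⟨FundamentalGroup.fromPath (Path.Homotopic.Quotient.mk q), ?_⟩
  refine F.val_congr _ _ fun t => Subtype.ext ?_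
  change (d' (q t) : X) = e' (circleLoop w t)
  rw [hd, he]
  exact hγ t

/-- At a suitable common point close to `p`, the circle of each chart lies in the patch of the
other, and it generates the group of its punctured patch. The two images are thus contained in each
other there, and moving the base points conjugates. No regularity of the change of charts is needed.
-/
theorem exists_range_hom_eq_conj {e d : RegularBall 2 X}
    {e' d' : C(PuncturedPlane, ({p}ᶜ : Set X))}
    (he : ∀ z, (e' z : X) = e.toFun z) (hd : ∀ z, (d' z : X) = d.toFun z)
    (he₀ : e.toFun 0 = p) (hd₀ : d.toFun 0 = p) (w v : PuncturedPlane) :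
    ∃ u : G, ((F.comap e').hom w).range =
      ((F.comap d').hom v).range.map (MulAut.conj u).toMonoidHom := by
  obtain ⟨ρ, hρ, h₁⟩ : ∃ ρ > 0, Metric.ball 0 ρ ⊆ d.toFun ⁻¹' Set.range e.toFun :=
    Metric.isOpen_iff.mp (e.isOpenEmbedding.isOpen_range.preimage d.isOpenEmbedding.continuous) 0
      ⟨0, he₀.trans hd₀.symm⟩
  obtain ⟨ε, hε, h₂⟩ : ∃ ε > 0, Metric.ball 0 ε ⊆ e.toFun ⁻¹' (d.toFun '' Metric.ball 0 ρ) :=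
    Metric.isOpen_iff.mp ((d.isOpenEmbedding.isOpenMap _ Metric.isOpen_ball).preimage
      e.isOpenEmbedding.continuous) 0 ⟨0, Metric.mem_ball_self hρ, hd₀.trans he₀.symm⟩
  -- The `e`-circle of radius `ε / 2` lies in the patch of `d`, and its point `w₁` has
  -- `d`-coordinate of norm below `ρ`, so the `d`-circle through it lies in the patch of `e`.
  obtain ⟨w₁, hw₁⟩ := exists_norm_eq Plane (half_pos hε).le
  have hw₁0 : w₁ ≠ 0 := norm_pos_iff.mp (by rw [hw₁]; positivity)
  obtain ⟨v₁, hv₁, hwv⟩ := h₂ (mem_ball_zero_iff.mpr (by rw [hw₁]; linarith : ‖w₁‖ < ε))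
  have hv₁0 : v₁ ≠ 0 := fun h => hw₁0 (e.isOpenEmbedding.injective (by
    rw [← hwv, h, hd₀, he₀]))
  let w' : PuncturedPlane := ⟨w₁, hw₁0⟩
  let v' : PuncturedPlane := ⟨v₁, hv₁0⟩
  have hwv' : e' w' = d' v' := Subtype.ext (by rw [he, hd]; exact hwv.symm)
  have key : ((F.comap e').hom w').range = ((F.comap d').hom v').range := by
    apply le_antisymm
    · rw [(F.comap e').range_hom_of_zpowers (zpowers_circleLoop w'), Subgroup.zpowers_le]
      refine val_circleLoop_mem_range F he hd hd₀ hwv' fun z hz => ?_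
      have hz' : ‖z‖ = ‖w₁‖ := hz
      exact Set.image_subset_range _ _
        (h₂ (mem_ball_zero_iff.mpr (by rw [hz', hw₁]; linarith : ‖z‖ < ε)))
    · rw [(F.comap d').range_hom_of_zpowers (zpowers_circleLoop v'), Subgroup.zpowers_le]
      refine val_circleLoop_mem_range F hd he he₀ hwv'.symm fun z hz => ?_
      have hz' : ‖z‖ = ‖v₁‖ := hz
      exact h₁ (mem_ball_zero_iff.mpr (by rw [hz']; exact mem_ball_zero_iff.mp hv₁ : ‖z‖ < ρ))
  refine ⟨(F.comap e').val (PathConnectedSpace.somePath w' w) *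
    (F.comap d').val (PathConnectedSpace.somePath v v'), ?_⟩
  rw [(F.comap e').range_hom_eq (PathConnectedSpace.somePath w' w), key,
    (F.comap d').range_hom_eq (PathConnectedSpace.somePath v v'), Subgroup.map_map, map_mul]
  rfl

end LocalLoop

section PuncturedTorusGroup

/-- Comparison with `torusChart` shows that the image of `g` generates a conjugate of the subgroup
of the commutator; an automorphism of the free group finishes. -/
theorem exists_mulEquiv_of_center {e : RegularBall 2 Torus}
    (he₀ : e.toFun 0 = (halfPoint, halfPoint))
    {e' : C(PuncturedPlane, PuncturedTorus)} (he : ∀ z, (e' z : Torus) = e.toFun z)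
    {w : PuncturedPlane} {g : FundamentalGroup PuncturedPlane w} (hg : Subgroup.zpowers g = ⊤) :
    ∃ Θ : FundamentalGroup PuncturedTorus (e' w) ≃* FreeGroup Bool,
      Θ (FundamentalGroup.map e' w g) = freeCommutator := by
  obtain ⟨F, hbij, hF⟩ := exists_torus_cocycle_bijective
  obtain ⟨u, hu⟩ := exists_range_hom_eq_conj F (d := ⟨torusChart, isOpenEmbedding_torusChart⟩)
    (d' := puncturedTorusChart) he (fun z => rfl) he₀ torusChart_zero w
    (unitCirclePoint (-(Real.pi / 4)))
  rw [(F.comap e').range_hom_of_zpowers hg,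
    (F.comap puncturedTorusChart).range_hom_of_zpowers (zpowers_circleLoop _)] at hu
  have h₁ : (F.comap puncturedTorusChart).hom (unitCirclePoint (-(Real.pi / 4)))
      (FundamentalGroup.fromPath (Path.Homotopic.Quotient.mk
        (circleLoop (unitCirclePoint (-(Real.pi / 4)))))) = freeCommutator := hF
  have h₂ : (F.comap e').hom w g = F.hom (e' w) (FundamentalGroup.map e' w g) := by
    obtain ⟨q⟩ := g
    rfl
  rw [h₁, h₂] at hu
  obtain ⟨θ, hθ⟩ := exists_freeGroup_mulEquiv u hu
  exact ⟨(MulEquiv.ofBijective (F.hom (e' w)) (hbij _)).trans θ, hθ⟩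

/-- A translation of the torus brings the center to `(1/2, 1/2)`. -/
theorem exists_mulEquiv_compl (e : RegularBall 2 Torus)
    {w : PuncturedPlane} {g : FundamentalGroup PuncturedPlane w} (hg : Subgroup.zpowers g = ⊤) :
    ∃ Θ : FundamentalGroup ({e.toFun 0}ᶜ : Set Torus) (e.punctured w) ≃* FreeGroup Bool,
      Θ (FundamentalGroup.map e.punctured w g) = freeCommutator := by
  let τ : Torus ≃ₜ Torus := Homeomorph.addRight ((halfPoint, halfPoint) - e.toFun 0)
  have hτ : τ (e.toFun 0) = (halfPoint, halfPoint) := add_sub_cancel _ _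
  let H : ({e.toFun 0}ᶜ : Set Torus) ≃ₜ PuncturedTorus := τ.subtype fun x => by
    simp only [Set.mem_compl_iff, Set.mem_singleton_iff, ← hτ, τ.injective.eq_iff]
  obtain ⟨Θ, hΘ⟩ := exists_mulEquiv_of_center
    (e := ⟨τ ∘ e.toFun, τ.isOpenEmbedding.comp e.isOpenEmbedding⟩) hτ
    (e' := (H : C(_, _)).comp e.punctured) (fun z => rfl) hg
  refine ⟨(H.fundamentalGroupEquiv _).trans Θ, ?_⟩
  rw [← hΘ]
  obtain ⟨q⟩ := g
  rfl

end PuncturedTorusGroup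

/-! ### The glued space as a union of two punctured spaces -/

section Inversion

/-- The unit sphere of the plane. -/
abbrev UnitSphere : Type := Metric.sphere (0 : EuclideanSpace ℝ (Fin 2)) 1

theorem PuncturedPlane.norm_pos (z : PuncturedPlane) : 0 < ‖(z : Plane)‖ := norm_pos_iff.mpr z.2

/-- The direction of a point of the punctured plane. -/
noncomputable def direction (z : PuncturedPlane) : UnitSphere :=
  ⟨‖(z : Plane)‖⁻¹ • (z : Plane), by
    rw [mem_sphere_zero_iff_norm, norm_smul, norm_inv, norm_norm,
      inv_mul_cancel₀ z.norm_pos.ne']⟩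

theorem continuous_inv_norm : Continuous fun z : PuncturedPlane => ‖(z : Plane)‖⁻¹ :=
  (continuous_norm.comp continuous_subtype_val).inv₀ fun z =>
    (PuncturedPlane.norm_pos z).ne'

theorem continuous_direction : Continuous direction :=
  (continuous_inv_norm.smul continuous_subtype_val).subtype_mk _

/-- The inversion of the punctured plane that acts on directions by a given map. -/
noncomputable def invMap (φ : UnitSphere → UnitSphere) (z : PuncturedPlane) : PuncturedPlane :=
  ⟨‖(z : Plane)‖⁻¹ • (φ (direction z) : Plane),
    smul_ne_zero (inv_ne_zero z.norm_pos.ne') (ne_zero_of_mem_unit_sphere _)⟩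

theorem norm_invMap (φ : UnitSphere → UnitSphere) (z : PuncturedPlane) :
    ‖(invMap φ z : Plane)‖ = ‖(z : Plane)‖⁻¹ := by
  rw [invMap, norm_smul, norm_inv, norm_norm, norm_eq_of_mem_sphere, mul_one]

theorem direction_invMap (φ : UnitSphere → UnitSphere) (z : PuncturedPlane) :
    direction (invMap φ z) = φ (direction z) := by
  refine Subtype.ext ?_
  change ‖(invMap φ z : Plane)‖⁻¹ • (‖(z : Plane)‖⁻¹ • (φ (direction z) : Plane)) = _
  rw [norm_invMap, inv_inv, smul_inv_smul₀ z.norm_pos.ne']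

theorem continuous_invMap {φ : UnitSphere → UnitSphere} (hφ : Continuous φ) :
    Continuous (invMap φ) :=
  (continuous_inv_norm.smul
    (continuous_subtype_val.comp (hφ.comp continuous_direction))).subtype_mk _

theorem invMap_invMap {φ ψ : UnitSphere → UnitSphere} (h : ∀ u, ψ (φ u) = u) (z : PuncturedPlane) :
    invMap ψ (invMap φ z) = z := by
  refine Subtype.ext ?_
  change ‖(invMap φ z : Plane)‖⁻¹ • (ψ (direction (invMap φ z)) : Plane) = z
  rw [direction_invMap, h, norm_invMap, inv_inv]
  exact smul_inv_smul₀ (ne_of_gt z.norm_pos) _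

/-- The inversion of the punctured plane that acts on directions by a given homeomorphism. -/
noncomputable def inversion (φ : UnitSphere ≃ₜ UnitSphere) : PuncturedPlane ≃ₜ PuncturedPlane where
  toFun := invMap φ
  invFun := invMap φ.symm
  left_inv := invMap_invMap φ.symm_apply_apply
  right_inv := invMap_invMap φ.apply_symm_apply
  continuous_toFun := continuous_invMap φ.continuous
  continuous_invFun := continuous_invMap φ.symm.continuous

theorem norm_inversion (φ : UnitSphere ≃ₜ UnitSphere) (z : PuncturedPlane) :
    ‖(inversion φ z : Plane)‖ = ‖(z : Plane)‖⁻¹ := norm_invMap φ z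

theorem inversion_of_mem_sphere (φ : UnitSphere ≃ₜ UnitSphere) {z : PuncturedPlane}
    (hz : (z : Plane) ∈ Metric.sphere (0 : Plane) 1) : (inversion φ z : Plane) = φ ⟨z, hz⟩ := by
  have h1 : ‖(z : Plane)‖ = 1 := mem_sphere_zero_iff_norm.mp hz
  have hd : direction z = ⟨z, hz⟩ := Subtype.ext (by simp [direction, h1])
  change ‖(z : Plane)‖⁻¹ • (φ (direction z) : Plane) = _
  rw [hd, h1, inv_one, one_smul]

/-- A point of the unit sphere as a point of the punctured plane. -/
def spherePoint (u : UnitSphere) : PuncturedPlane := ⟨u, ne_zero_of_mem_unit_sphere u⟩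

theorem inversion_spherePoint (φ : UnitSphere ≃ₜ UnitSphere) (u : UnitSphere) :
    inversion φ (spherePoint u) = spherePoint (φ u) :=
  Subtype.ext (inversion_of_mem_sphere φ (z := spherePoint u) u.2)

end Inversion

section Collapse

variable {X Y : Type*} [TopologicalSpace X] [TopologicalSpace Y]

open Classical in
/-- The map that turns the coordinate patch of `f` inside out onto the one of `e` and sends the
rest to the center of `e`. -/
noncomputable def collapse (e : RegularBall 2 X) (f : RegularBall 2 Y)
    (χ : PuncturedPlane → PuncturedPlane) (y : Y) : X :=
  if h : ∃ z : PuncturedPlane, f.toFun z = y then e.toFun (χ h.choose) else e.toFun 0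

variable (e : RegularBall 2 X) (f : RegularBall 2 Y)

theorem collapse_apply (χ : PuncturedPlane → PuncturedPlane) (z : PuncturedPlane) :
    collapse e f χ (f.toFun z) = e.toFun (χ z) := by
  have h : ∃ z' : PuncturedPlane, f.toFun z' = f.toFun z := ⟨z, rfl⟩
  rw [collapse, dif_pos h]
  congr 3
  exact Subtype.ext (f.isOpenEmbedding.injective h.choose_spec)

theorem collapse_of_notMem (χ : PuncturedPlane → PuncturedPlane) {y : Y}
    (h : ¬∃ z : PuncturedPlane, f.toFun z = y) : collapse e f χ y = e.toFun 0 := by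
  rw [collapse, dif_neg h]

theorem exists_of_collapse_ne {χ : PuncturedPlane → PuncturedPlane} {y : Y}
    (h : collapse e f χ y ≠ e.toFun 0) : ∃ z : PuncturedPlane, f.toFun z = y := by
  by_contra h'
  exact h (collapse_of_notMem e f χ h')

theorem toFun_ne_center (z : PuncturedPlane) : e.toFun z ≠ e.toFun 0 := fun h =>
  z.2 (e.isOpenEmbedding.injective h)

/-- On the punctured patch the map is `χ` in coordinates. Outside it, points near `y` are outside
the patch or have large coordinate, and `χ` inverts norms, so their images are near the center of
`e`. -/
theorem continuousAt_collapse [T2Space Y] {χ : PuncturedPlane → PuncturedPlane} (hχ : Continuous χ)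
    (hn : ∀ z, ‖(χ z : Plane)‖ = ‖(z : Plane)‖⁻¹) {y : Y} (hy : y ≠ f.toFun 0) :
    ContinuousAt (collapse e f χ) y := by
  by_cases h : ∃ z : PuncturedPlane, f.toFun z = y
  · obtain ⟨z, rfl⟩ := h
    have hf : IsOpenEmbedding fun z : PuncturedPlane => f.toFun z :=
      f.isOpenEmbedding.comp isOpen_compl_singleton.isOpenEmbedding_subtypeVal
    change ContinuousAt (collapse e f χ) ((fun z : PuncturedPlane => f.toFun z) z)
    rw [← hf.continuousAt_iff]
    have : collapse e f χ ∘ (fun z : PuncturedPlane => f.toFun z) = fun z => e.toFun (χ z) :=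
      funext fun z => collapse_apply e f χ z
    rw [this]
    exact (e.isOpenEmbedding.continuous.comp (continuous_subtype_val.comp hχ)).continuousAt
  · intro O hO
    rw [collapse_of_notMem e f χ h] at hO
    obtain ⟨ε, hε, hball⟩ := Metric.mem_nhds_iff.mp
      (e.isOpenEmbedding.continuous.continuousAt hO)
    -- Coordinates of norm larger than `ε⁻¹` are sent into the ball of radius `ε`; the others form a
    -- compact, hence closed, set that misses `y`.
    have hcl : IsClosed (f.toFun '' Metric.closedBall 0 ε⁻¹) :=
      ((isCompact_closedBall _ _).image f.isOpenEmbedding.continuous).isClosed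
    have hmem : y ∈ (f.toFun '' Metric.closedBall 0 ε⁻¹)ᶜ := by
      rintro ⟨z, -, rfl⟩
      exact h ⟨⟨z, fun h0 => hy (congrArg f.toFun h0)⟩, rfl⟩
    rw [Filter.mem_map]
    filter_upwards [hcl.isOpen_compl.mem_nhds hmem] with y' hy'
    by_cases h' : ∃ z : PuncturedPlane, f.toFun z = y'
    · obtain ⟨z, rfl⟩ := h'
      rw [Set.mem_preimage, collapse_apply]
      refine hball (mem_ball_zero_iff.mpr ?_)
      rw [hn]
      refine inv_lt_of_inv_lt₀ hε ?_
      by_contra! hz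
      exact hy' ⟨z, mem_closedBall_zero_iff.mpr hz, rfl⟩
    · rw [Set.mem_preimage, collapse_of_notMem e f χ h']
      exact mem_of_mem_nhds hO

theorem complement_ne_center {x : X} (hx : x ∈ e.complement) : x ≠ e.toFun 0 := by
  rintro rfl
  exact hx ⟨0, Metric.mem_ball_self one_pos, rfl⟩

theorem one_le_norm_of_mem_complement {z : Plane} (hz : e.toFun z ∈ e.complement) : 1 ≤ ‖z‖ := by
  by_contra! h
  exact hz ⟨z, mem_ball_zero_iff.mpr h, rfl⟩

theorem mem_complement_of_one_le_norm {z : Plane} (hz : 1 ≤ ‖z‖) : e.toFun z ∈ e.complement := by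
  rintro ⟨z', hz', h⟩
  rw [e.isOpenEmbedding.injective h] at hz'
  exact absurd (mem_ball_zero_iff.mp hz') (not_lt.mpr hz)

theorem isClosed_complement : IsClosed e.complement :=
  (e.isOpenEmbedding.isOpenMap _ Metric.isOpen_ball).isClosed_compl

end Collapse

section Glued

variable {X Y : Type*} [TopologicalSpace X] [TopologicalSpace Y]
  (e : RegularBall 2 X) (f : RegularBall 2 Y) (φ : UnitSphere ≃ₜ UnitSphere)

/-- The map from the glued space to the first space that fills the removed ball by the inverted
coordinate patch. -/
noncomputable def gluedLeft : GluedSum e f φ → X :=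
  Quot.lift (Sum.elim Subtype.val fun y => collapse e f (inversion φ).symm y) (by
    rintro _ _ ⟨u⟩
    change e.toFun (spherePoint u) =
      collapse e f (inversion φ).symm (f.toFun (spherePoint (φ u)))
    rw [← inversion_spherePoint, collapse_apply, Homeomorph.symm_apply_apply])

/-- The map from the glued space to the second space that fills the removed ball by the inverted
coordinate patch. -/
noncomputable def gluedRight : GluedSum e f φ → Y :=
  Quot.lift (Sum.elim (fun x => collapse f e (inversion φ) x) Subtype.val) (by
    rintro _ _ ⟨u⟩
    change collapse f e (inversion φ) (e.toFun (spherePoint u)) = f.toFun (spherePoint (φ u))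
    rw [collapse_apply, inversion_spherePoint])

theorem continuous_gluedLeft [T2Space Y] : Continuous (gluedLeft e f φ) := by
  refine continuous_quot_lift _ (continuous_subtype_val.sumElim ?_)
  exact continuous_iff_continuousAt.mpr fun y => ContinuousAt.comp (g := collapse e f _)
    (continuousAt_collapse e f (inversion φ).symm.continuous (norm_inversion φ.symm)
      (complement_ne_center f y.2)) continuous_subtype_val.continuousAt

theorem continuous_gluedRight [T2Space X] : Continuous (gluedRight e f φ) := by
  refine continuous_quot_lift _ (Continuous.sumElim ?_ continuous_subtype_val)
  exact continuous_iff_continuousAt.mpr fun y => ContinuousAt.comp (g := collapse f e _)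
    (continuousAt_collapse f e (inversion φ).continuous (norm_inversion φ)
      (complement_ne_center e y.2)) continuous_subtype_val.continuousAt

theorem compactSpace_gluedSum [CompactSpace X] [CompactSpace Y] :
    CompactSpace (GluedSum e f φ) := by
  have := isCompact_iff_compactSpace.mp (isClosed_complement e).isCompact
  have := isCompact_iff_compactSpace.mp (isClosed_complement f).isCompact
  infer_instance

/-- The part of the glued space that corresponds to the first space without the center. -/
def leftPart : Set (GluedSum e f φ) := gluedLeft e f φ ⁻¹' {e.toFun 0}ᶜ

/-- The part of the glued space that corresponds to the second space without the center. -/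
def rightPart : Set (GluedSum e f φ) := gluedRight e f φ ⁻¹' {f.toFun 0}ᶜ

theorem leftPart_union_rightPart : leftPart e f φ ∪ rightPart e f φ = Set.univ := by
  ext q
  simp only [Set.mem_univ, iff_true]
  obtain ⟨x | y⟩ := q
  · exact .inl (complement_ne_center e x.2)
  · exact .inr (complement_ne_center f y.2)

variable {e f φ}

/-- Both points being outside the open discs forces `‖z‖ ≥ 1` and `‖z‖⁻¹ ≥ 1`, so `z` is on the unit
circle, where the inversion is `φ` and the gluing applies. -/
theorem inl_eq_inr {x : e.complement} {y : f.complement} {z : PuncturedPlane}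
    (hx : e.toFun z = x) (hy : f.toFun (inversion φ z) = y) :
    (Quot.mk _ (Sum.inl x) : GluedSum e f φ) = Quot.mk _ (Sum.inr y) := by
  have h₁ : 1 ≤ ‖(z : Plane)‖ := one_le_norm_of_mem_complement e (hx ▸ x.2)
  have h₂ : 1 ≤ ‖(inversion φ z : Plane)‖ := one_le_norm_of_mem_complement f (hy ▸ y.2)
  rw [norm_inversion, one_le_inv₀ z.norm_pos] at h₂
  have hz : (z : Plane) ∈ Metric.sphere (0 : Plane) 1 :=
    mem_sphere_zero_iff_norm.mpr (le_antisymm h₂ h₁)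
  rw [inversion_of_mem_sphere φ hz] at hy
  have hx' : x = e.boundary ⟨z, hz⟩ := Subtype.ext hx.symm
  have hy' : y = f.boundary (φ ⟨z, hz⟩) := Subtype.ext hy.symm
  rw [hx', hy']
  exact Quot.sound (.glue _)

theorem gluedLeft_injOn : Set.InjOn (gluedLeft e f φ) (leftPart e f φ) := by
  have key : ∀ (x : e.complement) (y : f.complement),
      (Quot.mk _ (Sum.inr y) : GluedSum e f φ) ∈ leftPart e f φ →
      (x : X) = collapse e f (inversion φ).symm y →
      (Quot.mk _ (Sum.inl x) : GluedSum e f φ) = Quot.mk _ (Sum.inr y) := by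
    intro x y hy h
    obtain ⟨z, hz⟩ := exists_of_collapse_ne e f hy
    rw [← hz, collapse_apply] at h
    exact inl_eq_inr h.symm (by rw [Homeomorph.apply_symm_apply, hz])
  rintro ⟨x | y⟩ h ⟨x' | y'⟩ h' hh
  · exact congrArg (fun a => Quot.mk _ (Sum.inl a)) (Subtype.ext hh)
  · exact key x y' h' hh
  · exact (key x' y h hh.symm).symm
  · change collapse e f (inversion φ).symm y = collapse e f (inversion φ).symm y' at hh
    obtain ⟨z, hz⟩ := exists_of_collapse_ne e f h
    obtain ⟨z', hz'⟩ := exists_of_collapse_ne e f h'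
    rw [← hz, ← hz', collapse_apply, collapse_apply] at hh
    have : z = z' := (inversion φ).symm.injective
      (Subtype.ext (e.isOpenEmbedding.injective hh))
    subst this
    exact congrArg (fun a => Quot.mk _ (Sum.inr a)) (Subtype.ext (hz.symm.trans hz'))

theorem gluedRight_injOn : Set.InjOn (gluedRight e f φ) (rightPart e f φ) := by
  have key : ∀ (x : e.complement) (y : f.complement),
      (Quot.mk _ (Sum.inl x) : GluedSum e f φ) ∈ rightPart e f φ →
      collapse f e (inversion φ) x = y →
      (Quot.mk _ (Sum.inl x) : GluedSum e f φ) = Quot.mk _ (Sum.inr y) := by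
    intro x y hx h
    obtain ⟨z, hz⟩ := exists_of_collapse_ne f e hx
    rw [← hz, collapse_apply] at h
    exact inl_eq_inr hz h
  rintro ⟨x | y⟩ h ⟨x' | y'⟩ h' hh
  · change collapse f e (inversion φ) x = collapse f e (inversion φ) x' at hh
    obtain ⟨z, hz⟩ := exists_of_collapse_ne f e h
    obtain ⟨z', hz'⟩ := exists_of_collapse_ne f e h'
    rw [← hz, ← hz', collapse_apply, collapse_apply] at hh
    have : z = z' := (inversion φ).injective (Subtype.ext (f.isOpenEmbedding.injective hh))
    subst this
    exact congrArg (fun a => Quot.mk _ (Sum.inl a)) (Subtype.ext (hz.symm.trans hz'))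
  · exact key x y' h hh
  · exact (key x' y h' hh.symm).symm
  · exact congrArg (fun a => Quot.mk _ (Sum.inr a)) (Subtype.ext hh)

/-- The point is taken from the first piece when `‖z‖ ≥ 1` and from the second, through the
inversion, when `‖z‖ ≤ 1`. -/
theorem exists_gluedSum_point (z : PuncturedPlane) : ∃ q : GluedSum e f φ,
    gluedLeft e f φ q = e.toFun z ∧ gluedRight e f φ q = f.toFun (inversion φ z) := by
  rcases le_total 1 ‖(z : Plane)‖ with h | h
  · exact ⟨Quot.mk _ (Sum.inl ⟨e.toFun z, mem_complement_of_one_le_norm e h⟩), rfl,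
      collapse_apply f e (inversion φ) z⟩
  · refine ⟨Quot.mk _ (Sum.inr ⟨f.toFun (inversion φ z), mem_complement_of_one_le_norm f ?_⟩), ?_,
      rfl⟩
    · rw [norm_inversion]
      exact (one_le_inv₀ z.norm_pos).mpr h
    · exact (collapse_apply e f _ _).trans (by rw [Homeomorph.symm_apply_apply])

theorem gluedLeft_surjOn : Set.SurjOn (gluedLeft e f φ) (leftPart e f φ) {e.toFun 0}ᶜ := by
  intro x hx
  by_cases h : x ∈ e.complement
  · exact ⟨Quot.mk _ (Sum.inl ⟨x, h⟩), hx, rfl⟩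
  · obtain ⟨z, -, rfl⟩ := not_not.mp h
    obtain ⟨q, hq, -⟩ := exists_gluedSum_point (e := e) (f := f) (φ := φ)
      ⟨z, fun h0 => hx (congrArg e.toFun h0)⟩
    refine ⟨q, ?_, hq⟩
    change gluedLeft e f φ q ∈ ({e.toFun 0}ᶜ : Set X)
    rw [hq]
    exact hx

theorem gluedRight_surjOn : Set.SurjOn (gluedRight e f φ) (rightPart e f φ) {f.toFun 0}ᶜ := by
  intro y hy
  by_cases h : y ∈ f.complement
  · exact ⟨Quot.mk _ (Sum.inr ⟨y, h⟩), hy, rfl⟩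
  · obtain ⟨z, -, rfl⟩ := not_not.mp h
    obtain ⟨q, -, hq⟩ := exists_gluedSum_point (e := e) (f := f) (φ := φ)
      ((inversion φ).symm ⟨z, fun h0 => hy (congrArg f.toFun h0)⟩)
    rw [Homeomorph.apply_symm_apply] at hq
    refine ⟨q, ?_, hq⟩
    change gluedRight e f φ q ∈ ({f.toFun 0}ᶜ : Set Y)
    rw [hq]
    exact hy

/-- A continuous map from a compact space to a Hausdorff space restricts to a homeomorphism over
a set over which it is bijective. -/
noncomputable def homeomorphOfInjOn {Q Z : Type*} [TopologicalSpace Q] [TopologicalSpace Z]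
    [CompactSpace Q] [T2Space Z] {r : Q → Z} (hr : Continuous r) {S : Set Z}
    (hi : Set.InjOn r (r ⁻¹' S)) (hs : Set.SurjOn r (r ⁻¹' S) S) : ↥(r ⁻¹' S) ≃ₜ S :=
  (Equiv.ofBijective (S.restrictPreimage r)
    ⟨fun a b h => Subtype.ext (hi a.2 b.2 (congrArg Subtype.val h)), fun y => by
      obtain ⟨q, hq, h⟩ := hs y.2
      exact ⟨⟨q, hq⟩, Subtype.ext h⟩⟩).toHomeomorphOfContinuousClosed
    hr.restrictPreimage (hr.isClosedMap.restrictPreimage S)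

end Glued

/-! ### Amalgamation of two free groups along the commutator -/

section Amalgam

/-- The homomorphism from the free group on two letters to the presented group that hits the first
handle. -/
def firstHandle : FreeGroup Bool →* PresentedGroup {twoHoledRelator} :=
  FreeGroup.lift fun b => cond b (PresentedGroup.of .β₁) (PresentedGroup.of .α₁)

/-- The homomorphism from the free group on two letters to the presented group that hits the second
handle, with the orientation reversed. -/
def secondHandle : FreeGroup Bool →* PresentedGroup {twoHoledRelator} :=
  FreeGroup.lift fun b => cond b (PresentedGroup.of .α₂) (PresentedGroup.of .β₂)

/-- The second handle exchanges the roles of its letters, so its commutator is `[α₂, β₂]⁻¹`;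
equality of the two images is then the relator. -/
theorem firstHandle_commutator : firstHandle freeCommutator = secondHandle freeCommutator := by
  have h : (PresentedGroup.of .β₁ * PresentedGroup.of .α₁ * (PresentedGroup.of .β₁)⁻¹ *
      (PresentedGroup.of .α₁)⁻¹) * (PresentedGroup.of .β₂ * PresentedGroup.of .α₂ *
      (PresentedGroup.of .β₂)⁻¹ * (PresentedGroup.of .α₂)⁻¹) =
      (1 : PresentedGroup {twoHoledRelator}) :=
    PresentedGroup.one_of_mem (Set.mem_singleton _)
  rw [mul_eq_one_iff_eq_inv] at h
  simpa [firstHandle, secondHandle, freeCommutator, mul_assoc] using h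

theorem exists_presentedGroup_hom {G : Type*} [Group G] {i j : FreeGroup Bool →* G}
    (h : i freeCommutator = j freeCommutator) :
    ∃ Φ : PresentedGroup {twoHoledRelator} →* G,
      Φ.comp firstHandle = i ∧ Φ.comp secondHandle = j := by
  let gen : TwoHoledGen → G := fun a =>
    match a with
    | .α₁ => i (.of false)
    | .β₁ => i (.of true)
    | .α₂ => j (.of true)
    | .β₂ => j (.of false)
  have hr : ∀ r ∈ ({twoHoledRelator} : Set (FreeGroup TwoHoledGen)), FreeGroup.lift gen r = 1 := by
    rintro r rfl
    rw [← mul_inv_eq_one] at h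
    rw [← h]
    simp [twoHoledRelator, freeCommutator, gen, mul_assoc]
  refine ⟨PresentedGroup.toGroup hr, ?_, ?_⟩
  · ext b
    cases b <;> simp [firstHandle, gen]
  · ext b
    cases b <;> simp [secondHandle, gen]

theorem presentedGroup_hom_ext {G : Type*} [Group G] {p q : PresentedGroup {twoHoledRelator} →* G}
    (h₁ : p.comp firstHandle = q.comp firstHandle)
    (h₂ : p.comp secondHandle = q.comp secondHandle) : p = q := by
  refine PresentedGroup.ext fun a => ?_
  cases a
  · simpa [firstHandle] using DFunLike.congr_fun h₁ (.of false)
  · simpa [firstHandle] using DFunLike.congr_fun h₁ (.of true)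
  · simpa [secondHandle] using DFunLike.congr_fun h₂ (.of true)
  · simpa [secondHandle] using DFunLike.congr_fun h₂ (.of false)

variable {X : Type*} [TopologicalSpace X]

/-- The space and the presented group have the same universal property. On the cyclic group of the
overlap, compatibility has to be checked only on `g`; the homomorphisms obtained in both directions
are inverse to each other by the two uniqueness statements. -/
theorem nonempty_mulEquiv_of_vanKampen {U V : Set X} (oU : IsOpen U) (oV : IsOpen V)
    (hUV : U ∪ V = Set.univ) (pU : IsPathConnected U)
    (pV : IsPathConnected V) (pW : IsPathConnected (U ∩ V)) {x₀ : X} (h₀ : x₀ ∈ U ∩ V)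
    {g : FundamentalGroup ↥(U ∩ V) ⟨x₀, h₀⟩} (hg : Subgroup.zpowers g = ⊤)
    (A : FundamentalGroup U ⟨x₀, h₀.1⟩ ≃* FreeGroup Bool)
    (hA : A (FundamentalGroup.map (Set.inclMap Set.inter_subset_left) ⟨x₀, h₀⟩ g) = freeCommutator)
    (B : FundamentalGroup V ⟨x₀, h₀.2⟩ ≃* FreeGroup Bool)
    (hB : B (FundamentalGroup.map (Set.inclMap Set.inter_subset_right) ⟨x₀, h₀⟩ g) =
      freeCommutator) :
    Nonempty (FundamentalGroup X x₀ ≃* PresentedGroup {twoHoledRelator}) := by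
  obtain ⟨h, hU, hV⟩ := vanKampen_exists oU oV hUV pU pV pW h₀
    (firstHandle.comp A.toMonoidHom) (secondHandle.comp B.toMonoidHom) (fun γ => by
      have hγ : γ ∈ Subgroup.zpowers g := hg ▸ Subgroup.mem_top γ
      obtain ⟨n, rfl⟩ := hγ
      have hn := congrArg (· ^ n) ((congrArg firstHandle hA).trans
        (firstHandle_commutator.trans (congrArg secondHandle hB.symm)))
      simp only [map_zpow]
      exact (MonoidHom.map_zpow (firstHandle.comp A.toMonoidHom) _ n).trans
        (hn.trans (MonoidHom.map_zpow (secondHandle.comp B.toMonoidHom) _ n).symm))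
  let iU : FreeGroup Bool →* FundamentalGroup X x₀ :=
    (FundamentalGroup.map U.valMap (⟨x₀, h₀.1⟩ : U)).comp A.symm.toMonoidHom
  let iV : FreeGroup Bool →* FundamentalGroup X x₀ :=
    (FundamentalGroup.map V.valMap (⟨x₀, h₀.2⟩ : V)).comp B.symm.toMonoidHom
  have hiU : ∀ γ, iU (A γ) = FundamentalGroup.map U.valMap (⟨x₀, h₀.1⟩ : U) γ := fun γ =>
    congrArg (FundamentalGroup.map U.valMap (⟨x₀, h₀.1⟩ : U)) (A.symm_apply_apply γ)
  have hiV : ∀ γ, iV (B γ) = FundamentalGroup.map V.valMap (⟨x₀, h₀.2⟩ : V) γ := fun γ =>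
    congrArg (FundamentalGroup.map V.valMap (⟨x₀, h₀.2⟩ : V)) (B.symm_apply_apply γ)
  have hc : iU freeCommutator = iV freeCommutator := by
    refine (congrArg iU hA).symm.trans
      (((hiU _).trans (Eq.trans ?_ (hiV _).symm)).trans (congrArg iV hB))
    obtain ⟨q⟩ := g
    rfl
  obtain ⟨Φ, hΦU, hΦV⟩ := exists_presentedGroup_hom hc
  have e₁ : Φ.comp h = MonoidHom.id _ :=
    vanKampen_unique oU oV hUV pU pV pW h₀
      (fun γ => (congrArg Φ (hU γ)).trans ((DFunLike.congr_fun hΦU (A γ)).trans (hiU γ)))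
      fun γ => (congrArg Φ (hV γ)).trans ((DFunLike.congr_fun hΦV (B γ)).trans (hiV γ))
  have hhU : h.comp iU = firstHandle := by
    refine MonoidHom.ext fun y => ?_
    refine (hU (A.symm y)).trans ?_
    exact congrArg firstHandle (A.apply_symm_apply y)
  have hhV : h.comp iV = secondHandle := by
    refine MonoidHom.ext fun y => ?_
    refine (hV (B.symm y)).trans ?_
    exact congrArg secondHandle (B.apply_symm_apply y)
  have e₂ : h.comp Φ = MonoidHom.id _ := presentedGroup_hom_ext
    ((congrArg h.comp hΦU).trans hhU) ((congrArg h.comp hΦV).trans hhV)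
  exact ⟨h.toMulEquiv Φ e₁ e₂⟩

end Amalgam

/-! ### The overlap of the two parts is a punctured plane -/

section Overlap

variable {X Y : Type*} [TopologicalSpace X] [TopologicalSpace Y]

theorem Homeomorph.zpowers_map_eq_top (H : X ≃ₜ Y) {x : X} {g : FundamentalGroup X x}
    (hg : Subgroup.zpowers g = ⊤) :
    Subgroup.zpowers (FundamentalGroup.map (H : C(X, Y)) x g) = ⊤ := by
  rw [← MonoidHom.map_zpowers, hg]
  exact Subgroup.map_top_of_surjective _ (H.fundamentalGroupEquiv x).surjective

theorem exists_mulEquiv_of_comp_eq {Z G : Type*} [TopologicalSpace Z] [Group G] (H : X ≃ₜ Y)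
    {k : C(Z, X)} {η : C(Z, Y)} (hk : ∀ z, H (k z) = η z) {w : Z} {g : FundamentalGroup Z w} {c : G}
    (h : ∃ Θ : FundamentalGroup Y (η w) ≃* G, Θ (FundamentalGroup.map η w g) = c) :
    ∃ Θ : FundamentalGroup X (k w) ≃* G, Θ (FundamentalGroup.map k w g) = c := by
  obtain rfl : (H : C(X, Y)).comp k = η := ContinuousMap.ext hk
  obtain ⟨Θ, rfl⟩ := h
  refine ⟨(H.fundamentalGroupEquiv (k w)).trans Θ, ?_⟩
  obtain ⟨q⟩ := g
  rfl

theorem RegularBall.isEmbedding_punctured (e : RegularBall 2 X) : IsEmbedding e.punctured :=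
  .of_comp e.punctured.continuous continuous_subtype_val
    (e.isOpenEmbedding.isEmbedding.comp .subtypeVal)

variable [T2Space X] [T2Space Y] [CompactSpace X] [CompactSpace Y]
  (e : RegularBall 2 X) (f : RegularBall 2 Y) (φ : UnitSphere ≃ₜ UnitSphere)

/-- The first part of the glued space is the first space without a point. -/
noncomputable def leftHomeomorph : leftPart e f φ ≃ₜ ({e.toFun 0}ᶜ : Set X) :=
  haveI := compactSpace_gluedSum e f φ
  homeomorphOfInjOn (continuous_gluedLeft e f φ) gluedLeft_injOn gluedLeft_surjOn

/-- The second part of the glued space is the second space without a point. -/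
noncomputable def rightHomeomorph : rightPart e f φ ≃ₜ ({f.toFun 0}ᶜ : Set Y) :=
  haveI := compactSpace_gluedSum e f φ
  homeomorphOfInjOn (continuous_gluedRight e f φ) gluedRight_injOn gluedRight_surjOn

theorem leftHomeomorph_apply (q : leftPart e f φ) :
    (leftHomeomorph e f φ q : X) = gluedLeft e f φ q := rfl

theorem gluedLeft_symm (z : PuncturedPlane) :
    gluedLeft e f φ ((leftHomeomorph e f φ).symm (e.punctured z)) = e.toFun z := by
  rw [← leftHomeomorph_apply, Homeomorph.apply_symm_apply]
  rfl

/-- The point with given left coordinate is unique, so it is the one of `exists_gluedSum_point`,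
whose right coordinate is known. -/
theorem gluedRight_symm (z : PuncturedPlane) :
    gluedRight e f φ ((leftHomeomorph e f φ).symm (e.punctured z)) =
      f.toFun (inversion φ z) := by
  obtain ⟨q, hl, hr⟩ := exists_gluedSum_point (e := e) (f := f) (φ := φ) z
  have hq : q ∈ leftPart e f φ := by
    change gluedLeft e f φ q ∈ ({e.toFun 0}ᶜ : Set X)
    rw [hl]
    exact toFun_ne_center e z
  rw [← hr]
  congr 1
  refine gluedLeft_injOn (Subtype.prop _) hq ?_
  rw [gluedLeft_symm, hl]

/-- The coordinate patch as a parametrization of the overlap of the two parts. -/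
noncomputable def overlapMap : C(PuncturedPlane, ↥(leftPart e f φ ∩ rightPart e f φ)) :=
  ⟨fun z => ⟨(leftHomeomorph e f φ).symm (e.punctured z), Subtype.prop _, by
    change gluedRight e f φ _ ∈ ({f.toFun 0}ᶜ : Set Y)
    rw [gluedRight_symm]
    exact toFun_ne_center f _⟩, by
    refine Continuous.subtype_mk ?_ _
    exact continuous_subtype_val.comp
      ((leftHomeomorph e f φ).symm.continuous.comp e.punctured.continuous)⟩

theorem isEmbedding_overlapMap : IsEmbedding (overlapMap e f φ) := by
  have h : IsEmbedding (Subtype.val ∘ ((leftHomeomorph e f φ).symm ∘ e.punctured)) :=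
    IsEmbedding.subtypeVal.comp
      ((leftHomeomorph e f φ).symm.isEmbedding.comp e.isEmbedding_punctured)
  exact .of_comp (overlapMap e f φ).continuous continuous_subtype_val h

theorem surjective_overlapMap : Function.Surjective (overlapMap e f φ) := by
  rintro ⟨q, hl, hr⟩
  have key : ∃ z : PuncturedPlane, gluedLeft e f φ q = e.toFun z := by
    obtain ⟨x | y⟩ := q
    · obtain ⟨z, hz⟩ := exists_of_collapse_ne f e hr
      exact ⟨z, hz.symm⟩
    · obtain ⟨z, hz⟩ := exists_of_collapse_ne e f hl
      refine ⟨(inversion φ).symm z, ?_⟩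
      rw [← collapse_apply e f, hz]
      rfl
  obtain ⟨z, hz⟩ := key
  refine ⟨z, Subtype.ext (gluedLeft_injOn (Subtype.prop _) hl ?_)⟩
  exact (gluedLeft_symm e f φ z).trans hz.symm

/-- The overlap of the two parts is a punctured plane. -/
noncomputable def overlapHomeomorph : PuncturedPlane ≃ₜ ↥(leftPart e f φ ∩ rightPart e f φ) :=
  (isEmbedding_overlapMap e f φ).toHomeomorphOfSurjective (surjective_overlapMap e f φ)

end Overlap

/-! ### The fundamental group of the two-holed torus -/

section Conclusion

theorem isPathConnected_compl_torus (p : Torus) : IsPathConnected ({p}ᶜ : Set Torus) := by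
  let τ : Torus ≃ₜ Torus := Homeomorph.addRight (p - (halfPoint, halfPoint))
  have hτ : τ (halfPoint, halfPoint) = p := add_sub_cancel _ _
  have h : IsPathConnected ({(halfPoint, halfPoint)}ᶜ : Set Torus) :=
    isPathConnected_iff_pathConnectedSpace.mpr inferInstance
  have := h.image τ.continuous
  rwa [Set.image_compl_eq τ.bijective, Set.image_singleton, hτ] at this

theorem isPathConnected_of_homeomorph {X Y : Type*} [TopologicalSpace X] [TopologicalSpace Y]
    {S : Set X} {T : Set Y} (H : S ≃ₜ T) (hT : IsPathConnected T) : IsPathConnected S := by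
  have := isPathConnected_iff_pathConnectedSpace.mp hT
  exact isPathConnected_iff_pathConnectedSpace.mpr
    (H.symm.surjective.pathConnectedSpace H.symm.continuous)

variable (e f : RegularBall 2 Torus) (φ : UnitSphere ≃ₜ UnitSphere)

theorem isPathConnected_leftPart : IsPathConnected (leftPart e f φ) :=
  isPathConnected_of_homeomorph (leftHomeomorph e f φ) (isPathConnected_compl_torus _)

theorem isPathConnected_rightPart : IsPathConnected (rightPart e f φ) :=
  isPathConnected_of_homeomorph (rightHomeomorph e f φ) (isPathConnected_compl_torus _)

theorem isPathConnected_overlap : IsPathConnected (leftPart e f φ ∩ rightPart e f φ) :=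
  isPathConnected_iff_pathConnectedSpace.mpr
    ((surjective_overlapMap e f φ).pathConnectedSpace (overlapMap e f φ).continuous)

theorem pathConnectedSpace_gluedSum : PathConnectedSpace (GluedSum e f φ) := by
  rw [pathConnectedSpace_iff_univ, ← leftPart_union_rightPart]
  exact (isPathConnected_leftPart e f φ).union (isPathConnected_rightPart e f φ)
    (isPathConnected_overlap e f φ).nonempty

theorem nonempty_mulEquiv_gluedSum (x : GluedSum e f φ) :
    Nonempty (FundamentalGroup (GluedSum e f φ) x ≃* PresentedGroup {twoHoledRelator}) := by
  have := pathConnectedSpace_gluedSum e f φ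
  let w : PuncturedPlane := unitCirclePoint 0
  let g : FundamentalGroup PuncturedPlane w :=
    FundamentalGroup.fromPath (Path.Homotopic.Quotient.mk (circleLoop w))
  have hg : Subgroup.zpowers g = ⊤ := zpowers_circleLoop w
  obtain ⟨A, hA⟩ := exists_mulEquiv_of_comp_eq (leftHomeomorph e f φ)
    (k := (Set.inclMap Set.inter_subset_left).comp (overlapMap e f φ)) (η := e.punctured)
    (fun z => (leftHomeomorph e f φ).apply_symm_apply (e.punctured z))
    (exists_mulEquiv_compl e hg)
  -- Seen from the second torus the overlap is parametrized through the inversion. As a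
  -- homeomorphism it sends a generator to a generator, which is all that is needed, whether or not
  -- `φ` preserves orientation.
  obtain ⟨B, hB⟩ := exists_mulEquiv_of_comp_eq (rightHomeomorph e f φ)
    (k := (Set.inclMap Set.inter_subset_right).comp (overlapMap e f φ))
    (η := f.punctured.comp (inversion φ))
    (fun z => Subtype.ext (gluedRight_symm e f φ z)) (w := w) (g := g) (c := freeCommutator)
    (exists_mulEquiv_compl f ((inversion φ).zpowers_map_eq_top hg))
  obtain ⟨E⟩ := nonempty_mulEquiv_of_vanKampen
    (isOpen_compl_singleton.preimage (continuous_gluedLeft e f φ))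
    (isOpen_compl_singleton.preimage (continuous_gluedRight e f φ))
    (leftPart_union_rightPart e f φ) (isPathConnected_leftPart e f φ)
    (isPathConnected_rightPart e f φ) (isPathConnected_overlap e f φ)
    (overlapMap e f φ w).2 ((overlapHomeomorph e f φ).zpowers_map_eq_top hg) A hA B hB
  exact ⟨(FundamentalGroup.fundamentalGroupMulEquivOfPathConnected _ _).trans E⟩

end Conclusion

theorem mainTheorem3 (M : Type*) [TopologicalSpace M] (hM : IsConnectedSum 2 M Torus Torus)
    (x₀ : M) :
    Nonempty (FundamentalGroup M x₀ ≃* PresentedGroup {twoHoledRelator}) := by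
  obtain ⟨e, f, φ, ⟨H⟩⟩ := hM
  obtain ⟨E⟩ := nonempty_mulEquiv_gluedSum e f φ (H x₀)
  exact ⟨(H.fundamentalGroupEquiv x₀).trans E⟩
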